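/- **Theorem.** Let $k\ge 1$ be a fixed integer. Consider the problem Superset-Simultaneous-Dipaths with $k$ colors: given a finite digraph $D=(V,A)$ (parallel arcs allowed) with $A=A_1\cup\dots\cup A_k$, where the color classes $A_i$ need not be disjoint, two distinct vertices $s,t\in V$, and a conservative cost function $c\colon A\to\mathbb R$ (no directed cycle has negative cost; negative arc costs are allowed), find a set $A'\subseteq A$ minimizing $\sum_{a\in A'}c(a)$ among all sets $A'\subseteq A$ such that $A'\cap A_i$ contains an $s$-$t$ dipath for every $i\in\{1,\dots,k\}$, or report that no such set exists. For directed acyclic graphs $D$ this problem can be solved in polynomial time. Precisely: there are a program and a polynomial $p$, both depending only on $k$, such that on every instance with $D$ acyclic the program halts after at most $p(|V|+|A|)$ elementary operations with a correct answer, that is, with a set $A'$ of minimum cost if a feasible set exists and with the answer "infeasible" otherwise. Here programs run on a random access machine with memory cells for natural numbers and for real numbers, initially holding the list of arcs, the color classes, $s$, $t$ and the costs; the elementary operations are reading and writing a memory cell (with computed address), addition, subtraction (on natural numbers, truncated at $0$) and comparison of two numbers of the same kind. There is no multiplication, no division, no rounding and no conversion between the two kinds of numbers, and the only real constant is $0$.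 -/

import Mathlib

namespace SimPaths

/-! ### Digraphs, dipaths, and the optimization problem -/

/-- A finite digraph on the vertex set `Fin n` with arc set `Fin m`; the arc `a` goes from
`tail a` to `head a`. Parallel arcs are allowed, but not required. -/
structure ArcDigraph where
  n : ℕ
  m : ℕ
  tail : Fin m → Fin n
  head : Fin m → Fin n

namespace ArcDigraph

variable (D : ArcDigraph)

/-- The list of arcs is a directed walk from `u` to `v`. -/
def IsWalk : List (Fin D.m) → Fin D.n → Fin D.n → Prop
  | [], u, v => u = v
  | a :: l, u, v => D.tail a = u ∧ IsWalk l (D.head a) v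

/-- The list of arcs is a dipath from `u` to `v`: a directed walk that repeats no vertex. -/
def IsDipath (l : List (Fin D.m)) (u v : Fin D.n) : Prop :=
  D.IsWalk l u v ∧ (u :: l.map D.head).Nodup

/-- The list of arcs is a directed cycle through `v`: a closed directed walk with at least one arc
that repeats no vertex except for its two ends. -/
def IsDicycle (l : List (Fin D.m)) (v : Fin D.n) : Prop :=
  l ≠ [] ∧ D.IsWalk l v v ∧ (l.map D.head).Nodup

/-- The digraph has no directed cycle. -/
def IsAcyclic : Prop :=
  ∀ (v : Fin D.n) (l : List (Fin D.m)), ¬ D.IsDicycle l v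

/-- No directed cycle has negative cost. -/
def IsConservative (c : Fin D.m → ℝ) : Prop :=
  ∀ (v : Fin D.n) (l : List (Fin D.m)), D.IsDicycle l v → 0 ≤ (l.map c).sum

end ArcDigraph

/-- An instance of the problem with `k` color classes `color i`, not necessarily disjoint, which
together cover the arc set. -/
structure SimInstance (k : ℕ) extends ArcDigraph where
  color : Fin k → Finset (Fin m)
  covers : ∀ a, ∃ i, a ∈ color i
  s : Fin n
  t : Fin n
  s_ne_t : s ≠ t
  cost : Fin m → ℝ
  conservative : toArcDigraph.IsConservative cost

namespace SimInstance

variable {k : ℕ} (I : SimInstance k)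

/-- For every color `i`, the set `A' ∩ A_i` contains (all arcs of) an `s`-`t` dipath. -/
def IsFeasible (A' : Finset (Fin I.m)) : Prop :=
  ∀ i : Fin k, ∃ l : List (Fin I.m),
    I.toArcDigraph.IsDipath l I.s I.t ∧ ∀ a ∈ l, a ∈ A' ∩ I.color i

/-- `A'` is a feasible arc set of minimum cost. -/
def IsOptimal (A' : Finset (Fin I.m)) : Prop :=
  I.IsFeasible A' ∧
    ∀ B : Finset (Fin I.m), I.IsFeasible B → ∑ a ∈ A', I.cost a ≤ ∑ a ∈ B, I.cost a

end SimInstance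

/-! ### Random access programs

A random access machine has finitely many memory banks of natural numbers and finitely many memory
banks of real numbers (a program names only finitely many banks), each with cells indexed by `ℕ`
that can be addressed by a computed index. It adds, subtracts and compares; there is no
multiplication, no rounding, and no conversion between the two sorts of numbers, so that `T` steps
lengthen the binary representation of integers by `O(T)` bits only. -/

/-- The memory: `nat b i` and `real b i` are the contents of cell `i` of bank `b`. -/
structure Store where
  nat : ℕ → ℕ → ℕ
  real : ℕ → ℕ → ℝ

namespace Store

def setNat (σ : Store) (b i v : ℕ) : Store :=
  { σ with nat := Function.update σ.nat b (Function.update (σ.nat b) i v) }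

def setReal (σ : Store) (b i : ℕ) (v : ℝ) : Store :=
  { σ with real := Function.update σ.real b (Function.update (σ.real b) i v) }

end Store

/-- Expressions with a natural value; `sub` is truncated subtraction. -/
inductive NExpr where
  | lit (c : ℕ)
  | get (bank : ℕ) (index : NExpr)
  | add (e f : NExpr)
  | sub (e f : NExpr)

/-- Expressions with a real value; the only constant is `0`. -/
inductive RExpr where
  | zero
  | get (bank : ℕ) (index : NExpr)
  | add (e f : RExpr)
  | sub (e f : RExpr)

/-- Tests. -/
inductive Test where
  | natLE (e f : NExpr)
  | realLE (e f : RExpr)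
  | neg (b : Test)
  | conj (b c : Test)

def NExpr.eval (σ : Store) : NExpr → ℕ
  | .lit c => c
  | .get b i => σ.nat b (i.eval σ)
  | .add e f => e.eval σ + f.eval σ
  | .sub e f => e.eval σ - f.eval σ

noncomputable def RExpr.eval (σ : Store) : RExpr → ℝ
  | .zero => 0
  | .get b i => σ.real b (i.eval σ)
  | .add e f => e.eval σ + f.eval σ
  | .sub e f => e.eval σ - f.eval σ

def Test.Holds (σ : Store) : Test → Prop
  | .natLE e f => e.eval σ ≤ f.eval σ
  | .realLE e f => e.eval σ ≤ f.eval σ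
  | .neg b => ¬ b.Holds σ
  | .conj b c => b.Holds σ ∧ c.Holds σ

/-- The number of elementary operations (memory accesses included) in an evaluation. -/
def NExpr.ops : NExpr → ℕ
  | .lit _ => 1
  | .get _ i => i.ops + 1
  | .add e f => e.ops + f.ops + 1
  | .sub e f => e.ops + f.ops + 1

/-- The number of elementary operations (memory accesses included) in an evaluation. -/
def RExpr.ops : RExpr → ℕ
  | .zero => 1
  | .get _ i => i.ops + 1
  | .add e f => e.ops + f.ops + 1
  | .sub e f => e.ops + f.ops + 1

/-- The number of elementary operations (memory accesses included) in an evaluation. -/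
def Test.ops : Test → ℕ
  | .natLE e f => e.ops + f.ops + 1
  | .realLE e f => e.ops + f.ops + 1
  | .neg b => b.ops + 1
  | .conj b c => b.ops + c.ops + 1

/-- Programs: assignments to a memory cell with computed index, composition, conditionals, and
unbounded loops. -/
inductive Program where
  | skip
  | setNat (bank : ℕ) (index value : NExpr)
  | setReal (bank : ℕ) (index : NExpr) (value : RExpr)
  | seq (P Q : Program)
  | ite (b : Test) (P Q : Program)
  | loop (b : Test) (P : Program)

/-- `Runs P σ T σ'`: started on the memory `σ`, the program `P` halts with the memory `σ'` after
exactly `T` elementary operations. -/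
inductive Runs : Program → Store → ℕ → Store → Prop
  | skip (σ : Store) : Runs .skip σ 1 σ
  | setNat (σ : Store) (b : ℕ) (i e : NExpr) :
      Runs (.setNat b i e) σ (i.ops + e.ops + 1) (σ.setNat b (i.eval σ) (e.eval σ))
  | setReal (σ : Store) (b : ℕ) (i : NExpr) (e : RExpr) :
      Runs (.setReal b i e) σ (i.ops + e.ops + 1) (σ.setReal b (i.eval σ) (e.eval σ))
  | seq {P Q : Program} {σ₁ σ₂ σ₃ : Store} {T₁ T₂ : ℕ} :
      Runs P σ₁ T₁ σ₂ → Runs Q σ₂ T₂ σ₃ → Runs (.seq P Q) σ₁ (T₁ + T₂) σ₃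
  | iteTrue {b : Test} {P Q : Program} {σ σ' : Store} {T : ℕ} :
      b.Holds σ → Runs P σ T σ' → Runs (.ite b P Q) σ (b.ops + T + 1) σ'
  | iteFalse {b : Test} {P Q : Program} {σ σ' : Store} {T : ℕ} :
      ¬ b.Holds σ → Runs Q σ T σ' → Runs (.ite b P Q) σ (b.ops + T + 1) σ'
  | loopDone {b : Test} {P : Program} {σ : Store} :
      ¬ b.Holds σ → Runs (.loop b P) σ (b.ops + 1) σ
  | loopStep {b : Test} {P : Program} {σ₁ σ₂ σ₃ : Store} {T₁ T₂ : ℕ} :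
      b.Holds σ₁ → Runs P σ₁ T₁ σ₂ → Runs (.loop b P) σ₂ T₂ σ₃ →
      Runs (.loop b P) σ₁ (b.ops + T₁ + T₂ + 1) σ₃

/-! ### Input, output, and the task of an algorithm -/

namespace SimInstance

variable {k : ℕ} (I : SimInstance k)

/-- The memory at the start. Natural banks: bank `0` holds `n, m, s, t`, bank `1` the tails and
bank `2` the heads of the arcs, and bank `3 + i` the indicator function of the color class `i`.
Real bank `0` holds the costs of the arcs. All other cells hold `0`. -/
noncomputable def input : Store where
  nat b j :=
    if b = 0 then
      if j = 0 then I.n else if j = 1 then I.m else if j = 2 then I.s else if j = 3 then I.t else 0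
    else if hj : j < I.m then
      if b = 1 then I.tail ⟨j, hj⟩
      else if b = 2 then I.head ⟨j, hj⟩
      else if hb : b - 3 < k then
        if (⟨j, hj⟩ : Fin I.m) ∈ I.color ⟨b - 3, hb⟩ then 1 else 0
      else 0
    else 0
  real b j := if b = 0 then (if hj : j < I.m then I.cost ⟨j, hj⟩ else 0) else 0

/-- The arc set whose indicator function is in natural bank `1`. -/
def outputArcs (σ : Store) : Finset (Fin I.m) :=
  Finset.univ.filter fun a => σ.nat 1 a = 1

/-- The final memory `σ` is a correct answer: either natural bank `0` holds `1` in cell `0` and the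
output arc set is an optimal solution, or that cell holds `0` and there is no feasible solution. -/
def IsCorrectAnswer (σ : Store) : Prop :=
  (σ.nat 0 0 = 1 ∧ I.IsOptimal (I.outputArcs σ)) ∨
    (σ.nat 0 0 = 0 ∧ ∀ A' : Finset (Fin I.m), ¬ I.IsFeasible A')

end SimInstance

end SimPaths

/-!
The set may contain arcs of negative cost for free, so an optimal solution consists of all arcs of
negative cost and of the union of `k` dipaths, one of each color, that is as cheap as possible for
the *prices* `max (cost a) 0`.

Such a union is found by moving `k` tokens, one for each color, from `s` to `t`. A state gives the
positions of the tokens; it is a number below `n ^ k` whose digits in base `n` are the positions.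
The arcs are treated one after the other. In the step for an arc one may pay its price once and then
move along it any of the tokens that stand at its tail and whose color the arc has. For every state
the program keeps the cheapest way found so far to reach it. Each way that it finds is a set of arcs
containing walks of the right colors, at a price no smaller than that of the set
(`SimInstance.Sound`). Conversely, since the digraph is acyclic, there is a rank function below `n`
that increases along the arcs (`ArcDigraph.IsAcyclic.exists_rank`). If the arcs are treated in the
order of the ranks of their tails, then a feasible solution `B` can be followed so that each of its
arcs is paid at most once (`SimInstance.Completable`). The program does not sort the arcs: it runs
`n` rounds through all of them, and in the round `r` the proof only uses the steps for the arcs whose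
tail has rank `r`. Hence the entry for the state with all tokens at `t` costs at most the price of
`B` (`SimInstance.IsFeasible.cheap`).

The arc sets are stored as linked lists, whose nodes record the last arc and the preceding node, so
that a step for one state takes constant time. A relation between a program, a precondition and the
function that it computes, with a hidden polynomial time bound (`Computes`), is closed under
composition and under loops with polynomially many rounds; this gives `Program.main_spec`, which
reduces the theorem to statements about the final table `SimInstance.finalTab`.
-/

namespace SimPaths

/-! ### Running programs -/

namespace Program

/-- The program contains no loop. -/
def LoopFree : Program → Prop
  | .seq P Q => P.LoopFree ∧ Q.LoopFree
  | .ite _ P Q => P.LoopFree ∧ Q.LoopFree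
  | .loop _ _ => False
  | _ => True

open Classical in
/-- The memory after a run of a loop-free program (loops are ignored). -/
noncomputable def den : Program → Store → Store
  | .skip, σ => σ
  | .setNat b i e, σ => σ.setNat b (i.eval σ) (e.eval σ)
  | .setReal b i e, σ => σ.setReal b (i.eval σ) (e.eval σ)
  | .seq P Q, σ => Q.den (P.den σ)
  | .ite b P Q, σ => if b.Holds σ then P.den σ else Q.den σ
  | .loop _ _, σ => σ

/-- An upper bound for the running time of a loop-free program. -/
def cost : Program → ℕ
  | .skip => 1
  | .setNat _ i e => i.ops + e.ops + 1
  | .setReal _ i e => i.ops + e.ops + 1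
  | .seq P Q => P.cost + Q.cost
  | .ite b P Q => b.ops + (P.cost + Q.cost) + 1
  | .loop _ _ => 0

theorem LoopFree.exists_runs {P : Program} (hP : P.LoopFree) (σ : Store) :
    ∃ T ≤ P.cost, Runs P σ T (P.den σ) := by
  induction P generalizing σ with
  | skip => exact ⟨1, le_rfl, .skip σ⟩
  | setNat b i e => exact ⟨_, le_rfl, .setNat σ b i e⟩
  | setReal b i e => exact ⟨_, le_rfl, .setReal σ b i e⟩
  | seq P Q hP' hQ' =>
    obtain ⟨T₁, h₁, r₁⟩ := hP' hP.1 σ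
    obtain ⟨T₂, h₂, r₂⟩ := hQ' hP.2 (P.den σ)
    exact ⟨T₁ + T₂, add_le_add h₁ h₂, .seq r₁ r₂⟩
  | ite b P Q hP' hQ' =>
    by_cases hb : b.Holds σ
    · obtain ⟨T, h, r⟩ := hP' hP.1 σ
      refine ⟨_, ?_, by simpa only [den, if_pos hb] using Runs.iteTrue (Q := Q) hb r⟩
      simp only [cost]; omega
    · obtain ⟨T, h, r⟩ := hQ' hP.2 σ
      refine ⟨_, ?_, by simpa only [den, if_neg hb] using Runs.iteFalse (P := P) hb r⟩
      simp only [cost]; omega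
  | loop b P => exact hP.elim

end Program

/-! ### The memory layout -/

/-- The table of the dynamic program. The cell `F x` holds the number of a node, or `0` if the
state `x` has not been reached. Nodes are numbered from `1` to `cnt - 1`; a node `i ≥ 2` stands for
the arc set of the node `prev i` together with the arc `arc i`, the node `1` for the empty set.
The number `cost i` is the price paid for the arc set of the node `i`. -/
structure Tab where
  F : ℕ → ℕ
  prev : ℕ → ℕ
  arc : ℕ → ℕ
  cost : ℕ → ℝ
  cnt : ℕ

/-- The memory of the algorithm, with its cells named. The numbers are registers: `n`, `m`, `s`, `t`
from the input (`n` finally receives the verdict), the number `N = n ^ k` of states, the counters `r`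
of the rounds, `j` of the arcs and `x` of the states and of auxiliary loops, the weight `w = n ^ i` of the digit of the
current color, its multiples `tw`, `hw`, `w2` by the tail and the head of the arc and by `n`, the
remainder `q` of `x` modulo `w2`, the states `xs` and `xt` with all tokens at `s` and at `t`, and the
current node `id` of the output phase. The arrays `a1` and `a2` are the natural banks `1` and `2`,
`col` are the color classes and `c` the costs. -/
structure Mem where
  n : ℕ
  m : ℕ
  s : ℕ
  t : ℕ
  N : ℕ
  r : ℕ
  j : ℕ
  x : ℕ
  w : ℕ
  tw : ℕ
  hw : ℕ
  w2 : ℕ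
  q : ℕ
  xs : ℕ
  xt : ℕ
  id : ℕ
  a1 : ℕ → ℕ
  a2 : ℕ → ℕ
  col : ℕ → ℕ → ℕ
  c : ℕ → ℝ
  tab : Tab

namespace Mem

/-- The list of the registers, which occupy the natural bank `0`. -/
def regs (M : Mem) : List ℕ :=
  [M.n, M.m, M.s, M.t, M.N, M.r, M.j, M.x, M.w, M.tw, M.hw, M.w2, M.q, M.xs, M.xt, M.id,
    M.tab.cnt]

/-- The store with the named contents; the tables occupy the natural banks `3 + k`, `4 + k` and
`5 + k`, which the input leaves empty. -/
def toStore (k : ℕ) (M : Mem) : Store where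
  nat b i :=
    if b = 0 then M.regs.getD i 0 else if b = 1 then M.a1 i else if b = 2 then M.a2 i
    else if b < 3 + k then M.col (b - 3) i
    else if b = 3 + k then M.tab.F i else if b = 4 + k then M.tab.prev i
    else if b = 5 + k then M.tab.arc i else 0
  real b i := if b = 0 then M.c i else if b = 1 then M.tab.cost i else 0

variable (k : ℕ) (M : Mem)

@[simp] theorem toStore_nat_zero (i : ℕ) : (M.toStore k).nat 0 i = M.regs.getD i 0 := rfl
@[simp] theorem toStore_nat_one (i : ℕ) : (M.toStore k).nat 1 i = M.a1 i := rfl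
@[simp] theorem toStore_nat_two (i : ℕ) : (M.toStore k).nat 2 i = M.a2 i := rfl
@[simp] theorem toStore_nat_col (c : Fin k) (i : ℕ) :
    (M.toStore k).nat (3 + c) i = M.col c i := by
  simp [toStore, show ¬ (3 + (c : ℕ) = 1) by omega, show ¬ (3 + (c : ℕ) = 2) by omega]
@[simp] theorem toStore_nat_F (i : ℕ) : (M.toStore k).nat (3 + k) i = M.tab.F i := by
  simp [toStore, show ¬ (3 + k = 1) by omega, show ¬ (3 + k = 2) by omega]
@[simp] theorem toStore_nat_prev (i : ℕ) : (M.toStore k).nat (4 + k) i = M.tab.prev i := by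
  simp [toStore, show ¬ (4 + k = 1) by omega, show ¬ (4 + k = 2) by omega]
@[simp] theorem toStore_nat_arc (i : ℕ) : (M.toStore k).nat (5 + k) i = M.tab.arc i := by
  simp [toStore, show ¬ (5 + k = 1) by omega, show ¬ (5 + k = 2) by omega]
@[simp] theorem toStore_real_zero (i : ℕ) : (M.toStore k).real 0 i = M.c i := rfl
@[simp] theorem toStore_real_one (i : ℕ) : (M.toStore k).real 1 i = M.tab.cost i := rfl

variable {M} in
/-- A write to a register; the hypotheses hold by `rfl` for each single register. -/
theorem toStore_setNat_zero {M' : Mem} {i v : ℕ} (hi : i < 17) (h : M.regs.set i v = M'.regs)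
    (h₁ : M.a1 = M'.a1) (h₂ : M.a2 = M'.a2) (hc : M.col = M'.col) (hc' : M.c = M'.c)
    (hF : M.tab.F = M'.tab.F) (hp : M.tab.prev = M'.tab.prev) (ha : M.tab.arc = M'.tab.arc)
    (hco : M.tab.cost = M'.tab.cost) :
    (M.toStore k).setNat 0 i v = M'.toStore k := by
  simp only [Store.setNat, toStore, ← h, h₁, h₂, hc, hc', hF, hp, ha, hco]
  congr 1
  funext b j
  by_cases hb : b = 0
  · subst hb
    by_cases hj : j = i
    · subst hj
      simp [List.getD_eq_getElem?_getD, show j < M.regs.length from hi]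
    · simp [hj, List.getD_eq_getElem?_getD, Ne.symm hj]
  · simp [hb]

@[simp] theorem setNat_n (v : ℕ) : (M.toStore k).setNat 0 0 v = { M with n := v }.toStore k :=
  toStore_setNat_zero k (by norm_num) rfl rfl rfl rfl rfl rfl rfl rfl rfl

@[simp] theorem setNat_N (v : ℕ) : (M.toStore k).setNat 0 4 v = { M with N := v }.toStore k :=
  toStore_setNat_zero k (by norm_num) rfl rfl rfl rfl rfl rfl rfl rfl rfl

@[simp] theorem setNat_r (v : ℕ) : (M.toStore k).setNat 0 5 v = { M with r := v }.toStore k :=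
  toStore_setNat_zero k (by norm_num) rfl rfl rfl rfl rfl rfl rfl rfl rfl

@[simp] theorem setNat_j (v : ℕ) : (M.toStore k).setNat 0 6 v = { M with j := v }.toStore k :=
  toStore_setNat_zero k (by norm_num) rfl rfl rfl rfl rfl rfl rfl rfl rfl

@[simp] theorem setNat_x (v : ℕ) : (M.toStore k).setNat 0 7 v = { M with x := v }.toStore k :=
  toStore_setNat_zero k (by norm_num) rfl rfl rfl rfl rfl rfl rfl rfl rfl

@[simp] theorem setNat_w (v : ℕ) : (M.toStore k).setNat 0 8 v = { M with w := v }.toStore k :=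
  toStore_setNat_zero k (by norm_num) rfl rfl rfl rfl rfl rfl rfl rfl rfl

@[simp] theorem setNat_tw (v : ℕ) : (M.toStore k).setNat 0 9 v = { M with tw := v }.toStore k :=
  toStore_setNat_zero k (by norm_num) rfl rfl rfl rfl rfl rfl rfl rfl rfl

@[simp] theorem setNat_hw (v : ℕ) : (M.toStore k).setNat 0 10 v = { M with hw := v }.toStore k :=
  toStore_setNat_zero k (by norm_num) rfl rfl rfl rfl rfl rfl rfl rfl rfl

@[simp] theorem setNat_w2 (v : ℕ) : (M.toStore k).setNat 0 11 v = { M with w2 := v }.toStore k :=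
  toStore_setNat_zero k (by norm_num) rfl rfl rfl rfl rfl rfl rfl rfl rfl

@[simp] theorem setNat_q (v : ℕ) : (M.toStore k).setNat 0 12 v = { M with q := v }.toStore k :=
  toStore_setNat_zero k (by norm_num) rfl rfl rfl rfl rfl rfl rfl rfl rfl

@[simp] theorem setNat_xs (v : ℕ) : (M.toStore k).setNat 0 13 v = { M with xs := v }.toStore k :=
  toStore_setNat_zero k (by norm_num) rfl rfl rfl rfl rfl rfl rfl rfl rfl

@[simp] theorem setNat_xt (v : ℕ) : (M.toStore k).setNat 0 14 v = { M with xt := v }.toStore k :=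
  toStore_setNat_zero k (by norm_num) rfl rfl rfl rfl rfl rfl rfl rfl rfl

@[simp] theorem setNat_id (v : ℕ) : (M.toStore k).setNat 0 15 v = { M with id := v }.toStore k :=
  toStore_setNat_zero k (by norm_num) rfl rfl rfl rfl rfl rfl rfl rfl rfl

@[simp] theorem setNat_cnt (v : ℕ) :
    (M.toStore k).setNat 0 16 v = { M with tab := { M.tab with cnt := v } }.toStore k :=
  toStore_setNat_zero k (by norm_num) rfl rfl rfl rfl rfl rfl rfl rfl rfl

@[simp] theorem setNat_a1 (i v : ℕ) :
    (M.toStore k).setNat 1 i v = { M with a1 := Function.update M.a1 i v }.toStore k := by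
  simp only [Store.setNat, toStore]
  congr 1
  funext b j
  by_cases hb : b = 1
  · subst hb; simp [Function.update_apply]
  · simp [hb, regs]

@[simp] theorem setNat_F (i v : ℕ) :
    (M.toStore k).setNat (3 + k) i v =
      { M with tab := { M.tab with F := Function.update M.tab.F i v } }.toStore k := by
  simp only [Store.setNat, toStore]
  congr 1
  funext b j
  by_cases hb : b = 3 + k
  · subst hb
    simp [Function.update_apply, show ¬ (3 + k = 1) by omega, show ¬ (3 + k = 2) by omega]
  · simp [hb, regs]

@[simp] theorem setNat_prev (i v : ℕ) :
    (M.toStore k).setNat (4 + k) i v =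
      { M with tab := { M.tab with prev := Function.update M.tab.prev i v } }.toStore k := by
  simp only [Store.setNat, toStore]
  congr 1
  funext b j
  by_cases hb : b = 4 + k
  · subst hb
    simp [Function.update_apply, show ¬ (4 + k = 1) by omega, show ¬ (4 + k = 2) by omega]
  · simp [hb, regs]

@[simp] theorem setNat_arc (i v : ℕ) :
    (M.toStore k).setNat (5 + k) i v =
      { M with tab := { M.tab with arc := Function.update M.tab.arc i v } }.toStore k := by
  simp only [Store.setNat, toStore]
  congr 1
  funext b j
  by_cases hb : b = 5 + k
  · subst hb
    simp [Function.update_apply, show ¬ (5 + k = 1) by omega, show ¬ (5 + k = 2) by omega]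
  · simp [hb, regs]

@[simp] theorem setReal_cost (i : ℕ) (v : ℝ) :
    (M.toStore k).setReal 1 i v =
      { M with tab := { M.tab with cost := Function.update M.tab.cost i v } }.toStore k := by
  simp only [Store.setReal, toStore]
  congr 1
  funext b j
  by_cases hb : b = 1
  · subst hb; simp [Function.update_apply]
  · simp [hb]

end Mem

/-! ### Programs that run in polynomial time -/

/-- From every memory `M` that satisfies `pre I M`, the program computes the memory `f I M`, in time
polynomial in the number of vertices and arcs of the instance `I`. -/
def Computes {k : ℕ} (P : Program) (pre : SimInstance k → Mem → Prop)
    (f : SimInstance k → Mem → Mem) : Prop :=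
  ∃ p : Polynomial ℕ, ∀ I M, pre I M →
    ∃ T ≤ p.eval (I.n + I.m), Runs P (M.toStore k) T ((f I M).toStore k)

namespace Computes

variable {k : ℕ} {P Q : Program} {pre pre' : SimInstance k → Mem → Prop}
  {f g : SimInstance k → Mem → Mem}

theorem of_loopFree (hP : P.LoopFree)
    (h : ∀ I M, pre I M → P.den (M.toStore k) = (f I M).toStore k) : Computes P pre f := by
  refine ⟨Polynomial.C P.cost, fun I M hM => ?_⟩
  obtain ⟨T, hT, r⟩ := hP.exists_runs (M.toStore k)
  exact ⟨T, by simpa using hT, h I M hM ▸ r⟩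

theorem mono (h : Computes P pre f) (hpre : ∀ I M, pre' I M → pre I M)
    (hf : ∀ I M, pre' I M → f I M = g I M) : Computes P pre' g := by
  obtain ⟨p, hp⟩ := h
  exact ⟨p, fun I M hM => hf I M hM ▸ hp I M (hpre I M hM)⟩

theorem seq (hP : Computes P pre f) (hQ : Computes Q pre' g)
    (h : ∀ I M, pre I M → pre' I (f I M)) :
    Computes (.seq P Q) pre (fun I M => g I (f I M)) := by
  obtain ⟨p, hp⟩ := hP
  obtain ⟨q, hq⟩ := hQ
  refine ⟨p + q, fun I M hM => ?_⟩
  obtain ⟨T₁, h₁, r₁⟩ := hp I M hM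
  obtain ⟨T₂, h₂, r₂⟩ := hq I _ (h I M hM)
  exact ⟨T₁ + T₂, by rw [Polynomial.eval_add]; exact add_le_add h₁ h₂, .seq r₁ r₂⟩

/-- A loop that runs through the memories `g I M 0 = M, …, g I M (c I M)` and stops there. -/
theorem loop {b : Test} (hP : Computes P pre f) {g : SimInstance k → Mem → ℕ → Mem}
    {c : SimInstance k → Mem → ℕ} (q : Polynomial ℕ)
    (h0 : ∀ I M, pre' I M → g I M 0 = M)
    (hstep : ∀ I M i, pre' I M → i < c I M →
      pre I (g I M i) ∧ b.Holds ((g I M i).toStore k) ∧ f I (g I M i) = g I M (i + 1))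
    (hend : ∀ I M, pre' I M → ¬ b.Holds ((g I M (c I M)).toStore k))
    (hc : ∀ I M, pre' I M → c I M ≤ q.eval (I.n + I.m)) :
    Computes (.loop b P) pre' (fun I M => g I M (c I M)) := by
  obtain ⟨p, hp⟩ := hP
  refine ⟨(q + 1) * (p + Polynomial.C (b.ops + 1)), fun I M hM => ?_⟩
  set B := p.eval (I.n + I.m) + (b.ops + 1) with hB
  have key : ∀ d ≤ c I M, ∃ T ≤ (d + 1) * B,
      Runs (.loop b P) ((g I M (c I M - d)).toStore k) T ((g I M (c I M)).toStore k) := by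
    intro d
    induction d with
    | zero =>
      intro _
      exact ⟨b.ops + 1, by omega, .loopDone (hend I M hM)⟩
    | succ d ih =>
      intro hd
      obtain ⟨T₂, h₂, r₂⟩ := ih (by omega)
      obtain ⟨hpre, hb, hf⟩ := hstep I M (c I M - (d + 1)) hM (by omega)
      obtain ⟨T₁, h₁, r₁⟩ := hp I _ hpre
      rw [hf, show c I M - (d + 1) + 1 = c I M - d by omega] at r₁
      refine ⟨_, ?_, .loopStep hb r₁ r₂⟩
      have : (d + 1 + 1) * B = (d + 1) * B + B := by ring
      omega
  obtain ⟨T, hT, r⟩ := key (c I M) le_rfl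
  rw [Nat.sub_self, h0 I M hM] at r
  refine ⟨T, hT.trans ?_, r⟩
  simp only [Polynomial.eval_mul, Polynomial.eval_add, Polynomial.eval_one, Polynomial.eval_C]
  exact Nat.mul_le_mul_right _ (Nat.add_le_add_right (hc I M hM) 1)

/-- A loop of `c I M` rounds, given by an invariant that holds before the round `i`. -/
theorem loop_iterate {b : Test} (hP : Computes P pre f) (inv : SimInstance k → Mem → ℕ → Mem → Prop)
    {c : SimInstance k → Mem → ℕ} (q : Polynomial ℕ)
    (h0 : ∀ I M, pre' I M → inv I M 0 M)
    (hstep : ∀ I M i M', pre' I M → i < c I M → inv I M i M' →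
      pre I M' ∧ b.Holds (M'.toStore k) ∧ inv I M (i + 1) (f I M'))
    (hend : ∀ I M M', pre' I M → inv I M (c I M) M' → ¬ b.Holds (M'.toStore k))
    (hc : ∀ I M, pre' I M → c I M ≤ q.eval (I.n + I.m)) :
    Computes (.loop b P) pre' (fun I M => (f I)^[c I M] M) ∧
      ∀ I M, pre' I M → inv I M (c I M) ((f I)^[c I M] M) := by
  have key : ∀ I M, pre' I M → ∀ i ≤ c I M, inv I M i ((f I)^[i] M) := by
    intro I M hM i
    induction i with
    | zero => exact fun _ => h0 I M hM
    | succ i ih =>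
      intro hi
      rw [Function.iterate_succ_apply']
      exact (hstep I M i _ hM hi (ih (by omega))).2.2
  refine ⟨hP.loop (g := fun I M i => (f I)^[i] M) q (fun _ _ _ => rfl) (fun I M i hM hi => ?_)
    (fun I M hM => hend I M _ hM (key I M hM _ le_rfl)) hc, fun I M hM => key I M hM _ le_rfl⟩
  have := hstep I M i _ hM hi (key I M hM i hi.le)
  exact ⟨this.1, this.2.1, (Function.iterate_succ_apply' _ _ _).symm⟩

end Computes

/-! ### Building blocks of the program -/

/-! The registers as expressions. -/

namespace Reg

def n : NExpr := .get 0 (.lit 0)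
def m : NExpr := .get 0 (.lit 1)
def s : NExpr := .get 0 (.lit 2)
def t : NExpr := .get 0 (.lit 3)
def N : NExpr := .get 0 (.lit 4)
def r : NExpr := .get 0 (.lit 5)
def j : NExpr := .get 0 (.lit 6)
def x : NExpr := .get 0 (.lit 7)
def w : NExpr := .get 0 (.lit 8)
def tw : NExpr := .get 0 (.lit 9)
def hw : NExpr := .get 0 (.lit 10)
def w2 : NExpr := .get 0 (.lit 11)
def q : NExpr := .get 0 (.lit 12)
def xs : NExpr := .get 0 (.lit 13)
def xt : NExpr := .get 0 (.lit 14)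
def id : NExpr := .get 0 (.lit 15)
def cnt : NExpr := .get 0 (.lit 16)

variable (k : ℕ) (M : Mem)

@[simp] theorem eval_n : n.eval (M.toStore k) = M.n := rfl
@[simp] theorem eval_m : m.eval (M.toStore k) = M.m := rfl
@[simp] theorem eval_s : s.eval (M.toStore k) = M.s := rfl
@[simp] theorem eval_t : t.eval (M.toStore k) = M.t := rfl
@[simp] theorem eval_N : N.eval (M.toStore k) = M.N := rfl
@[simp] theorem eval_r : r.eval (M.toStore k) = M.r := rfl
@[simp] theorem eval_j : j.eval (M.toStore k) = M.j := rfl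
@[simp] theorem eval_x : x.eval (M.toStore k) = M.x := rfl
@[simp] theorem eval_w : w.eval (M.toStore k) = M.w := rfl
@[simp] theorem eval_tw : tw.eval (M.toStore k) = M.tw := rfl
@[simp] theorem eval_hw : hw.eval (M.toStore k) = M.hw := rfl
@[simp] theorem eval_w2 : w2.eval (M.toStore k) = M.w2 := rfl
@[simp] theorem eval_q : q.eval (M.toStore k) = M.q := rfl
@[simp] theorem eval_xs : xs.eval (M.toStore k) = M.xs := rfl
@[simp] theorem eval_xt : xt.eval (M.toStore k) = M.xt := rfl
@[simp] theorem eval_id : id.eval (M.toStore k) = M.id := rfl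
@[simp] theorem eval_cnt : cnt.eval (M.toStore k) = M.tab.cnt := rfl

end Reg

namespace Program

/-- Assignment to a register. -/
def setReg (i : ℕ) (e : NExpr) : Program := .setNat 0 (.lit i) e

@[simp] theorem den_setReg (i : ℕ) (e : NExpr) (σ : Store) :
    (setReg i e).den σ = σ.setNat 0 i (e.eval σ) := rfl

/-- Increment of the register `i`, whose content is given by the expression `e`. -/
def incr (i : ℕ) (e : NExpr) : Program := setReg i (.add e (.lit 1))

@[simp] theorem den_incr (i : ℕ) (e : NExpr) (σ : Store) :
    (incr i e).den σ = σ.setNat 0 i (e.eval σ + 1) := rfl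

/-- The loop `while e < f`. -/
def loopLT (e f : NExpr) (P : Program) : Program := .loop (.neg (.natLE f e)) P

end Program

/-- The table cell with the given address. -/
def NExpr.F (k : ℕ) (e : NExpr) : NExpr := .get (3 + k) e

@[simp] theorem NExpr.eval_F (k : ℕ) (e : NExpr) (M : Mem) :
    (e.F k).eval (M.toStore k) = M.tab.F (e.eval (M.toStore k)) := by
  simp [NExpr.F, NExpr.eval]

/-- The test `e ≠ 0`. -/
def NExpr.isPos (e : NExpr) : Test := .natLE (.lit 1) e

@[simp] theorem NExpr.holds_isPos (e : NExpr) (σ : Store) :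
    e.isPos.Holds σ ↔ e.eval σ ≠ 0 := by
  simp [NExpr.isPos, Test.Holds, NExpr.eval, Nat.one_le_iff_ne_zero]

/-! ### Operations on the table -/

namespace Tab

open Classical in
/-- Copy the entry of the cell `x` to the cell `y` if this makes the latter cheaper. -/
noncomputable def relax (T : Tab) (y x : ℕ) : Tab :=
  if T.F x ≠ 0 ∧ ¬ (T.F y ≠ 0 ∧ T.cost (T.F y) ≤ T.cost (T.F x)) then
    { T with F := Function.update T.F y (T.F x) } else T

/-- Create a node that extends the entry of the cell `x` by the arc `a` of price `p`, and enter it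
at the cell `y`. If the cell `x` is empty, then the cell `y` is emptied, and the new node is never
used. -/
noncomputable def alloc (T : Tab) (a : ℕ) (p : ℝ) (y x : ℕ) : Tab where
  F := Function.update T.F y (if T.F x = 0 then 0 else T.cnt)
  prev := Function.update T.prev T.cnt (T.F x)
  arc := Function.update T.arc T.cnt a
  cost := Function.update T.cost T.cnt (T.cost (T.F x) + p)
  cnt := T.cnt + 1

/-- Apply the operations `f · 0, …, f · (N - 1)` in this order. -/
def sweep (f : Tab → ℕ → Tab) : ℕ → Tab → Tab
  | 0, T => T
  | i + 1, T => f (sweep f i T) i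

/-- The nodes of the table represent the arc sets `G i`. -/
structure Chain {m : ℕ} (T : Tab) (G : ℕ → Finset (Fin m)) : Prop where
  empty : ∀ i < 2, G i = ∅
  prev_lt : ∀ i, 2 ≤ i → i < T.cnt → T.prev i < i
  insert : ∀ i, 2 ≤ i → i < T.cnt → ∃ a : Fin m, (a : ℕ) = T.arc i ∧ G i = insert a (G (T.prev i))

end Tab

namespace Program

/-- The program for `Tab.relax`. -/
def relax (k : ℕ) (y x : NExpr) : Program :=
  .ite (.conj (x.F k).isPos
      (.neg (.conj (y.F k).isPos (.realLE (.get 1 (y.F k)) (.get 1 (x.F k))))))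
    (.setNat (3 + k) y (x.F k)) .skip

theorem loopFree_relax (k : ℕ) (y x : NExpr) : (relax k y x).LoopFree := ⟨trivial, trivial⟩

@[simp] theorem den_relax (k : ℕ) (y x : NExpr) (M : Mem) :
    (relax k y x).den (M.toStore k) =
      { M with tab := M.tab.relax (y.eval (M.toStore k)) (x.eval (M.toStore k)) }.toStore k := by
  simp only [relax, den, Test.Holds, NExpr.holds_isPos, NExpr.eval_F, RExpr.eval,
    Mem.toStore_real_one, Tab.relax]
  split_ifs <;> simp

/-- The program for `Tab.alloc`, for the arc `j` and the cells `x` and `N + x`. -/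
def alloc (k : ℕ) : Program :=
  .seq (.setNat (4 + k) Reg.cnt (Reg.x.F k)) <|
  .seq (.setNat (5 + k) Reg.cnt Reg.j) <|
  .seq (.ite (.realLE .zero (.get 0 Reg.j))
    (.setReal 1 Reg.cnt (.add (.get 1 (Reg.x.F k)) (.get 0 Reg.j)))
    (.setReal 1 Reg.cnt (.get 1 (Reg.x.F k)))) <|
  .seq (.ite (Reg.x.F k).isPos (.setNat (3 + k) (.add Reg.N Reg.x) Reg.cnt)
    (.setNat (3 + k) (.add Reg.N Reg.x) (.lit 0))) <|
  incr 16 Reg.cnt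

theorem loopFree_alloc (k : ℕ) : (alloc k).LoopFree :=
  ⟨trivial, trivial, ⟨trivial, trivial⟩, ⟨trivial, trivial⟩, trivial⟩

@[simp] theorem den_alloc (k : ℕ) (M : Mem) :
    (alloc k).den (M.toStore k) =
      { M with tab := M.tab.alloc M.j (max (M.c M.j) 0) (M.N + M.x) M.x }.toStore k := by
  simp only [alloc, den, Test.Holds, NExpr.holds_isPos, NExpr.eval_F, RExpr.eval, NExpr.eval,
    Mem.setNat_prev, Mem.setNat_arc, Reg.eval_cnt, Reg.eval_j, Reg.eval_x, Mem.toStore_real_zero,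
    Mem.toStore_real_one]
  have hmax : max (M.c M.j) 0 = if 0 ≤ M.c M.j then M.c M.j else 0 := by
    split_ifs with h
    exacts [max_eq_left h, max_eq_right (not_le.mp h).le]
  rw [hmax]
  by_cases hc : 0 ≤ M.c M.j <;> by_cases hF : M.tab.F M.x = 0 <;>
    simp [hc, hF, Tab.alloc]

end Program

/-! ### Programs for one step of the dynamic program -/

/-- The memory holds the instance, the number `n ^ k` of states and the states in which all tokens
are at `s` and at `t`. -/
structure Ready {k : ℕ} (I : SimInstance k) (M : Mem) : Prop where
  n : M.n = I.n
  m : M.m = I.m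
  a1 : ∀ a : Fin I.m, M.a1 a = I.tail a
  a2 : ∀ a : Fin I.m, M.a2 a = I.head a
  col : ∀ (i : Fin k) (a : Fin I.m), M.col i a = if a ∈ I.color i then 1 else 0
  c : ∀ a : Fin I.m, M.c a = I.cost a
  N : M.N = I.n ^ k
  xs : M.xs = ∑ i ∈ Finset.range k, I.s * I.n ^ i
  xt : M.xt = ∑ i ∈ Finset.range k, I.t * I.n ^ i

open Classical in
/-- The operation at the state `x` for a token whose position is the digit of weight `w` of `x` in
base `n`, and an arc from `u` to `v`: within a transaction, the token moves from `u` to `v`. The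
condition `p` says that the arc has the color of the token; `N` is the number of states. -/
noncomputable def Tab.move (p : Prop) (N n w u v : ℕ) (T : Tab) (x : ℕ) : Tab :=
  if p ∧ x / w % n = u then T.relax (N + (x + v * w - u * w)) (N + x) else T

namespace Program

/-- Run `P` for `x = 0, …, N - 1`, while `q` keeps the value `x % w2` (which is `x` if `w2 = 0`):
there is no division, so the remainder is counted along. -/
def sweep (P : Program) : Program :=
  .seq (.seq (setReg 7 (.lit 0)) (setReg 12 (.lit 0))) <|
  loopLT Reg.x Reg.N <| .seq P <| .seq (incr 7 Reg.x) <|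
    .ite (.conj (.natLE (.add Reg.q (.lit 1)) Reg.w2) (.natLE Reg.w2 (.add Reg.q (.lit 1))))
      (setReg 12 (.lit 0)) (incr 12 Reg.q)

theorem succ_mod_eq_ite (i w : ℕ) : (i + 1) % w = if i % w + 1 = w then 0 else i % w + 1 := by
  rcases Nat.eq_zero_or_pos w with rfl | hw
  · simp
  · rw [Nat.add_mod]
    rcases Nat.lt_or_ge 1 w with h | h
    · rw [Nat.mod_eq_of_lt h]
      have := Nat.mod_lt i hw
      split_ifs with h'
      · rw [h', Nat.mod_self]
      · exact Nat.mod_eq_of_lt (by omega)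
    · obtain rfl : w = 1 := by omega
      simp [Nat.mod_one]

theorem computes_sweep {k : ℕ} {P : Program} (hP : P.LoopFree) (op : Mem → Tab → ℕ → Tab)
    (hop : ∀ M x q T, op { M with x := x, q := q, tab := T } = op M)
    {pre : SimInstance k → Mem → Prop} (hpre : ∀ I M, pre I M → M.N = I.n ^ k)
    (hpre' : ∀ I M x q T, pre I M → pre I { M with x := x, q := q, tab := T })
    (h : ∀ I M, pre I M → M.q = M.x % M.w2 →
      P.den (M.toStore k) = { M with tab := op M M.tab M.x }.toStore k) :
    Computes P.sweep pre fun _ M =>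
      { M with x := M.N, q := M.N % M.w2, tab := Tab.sweep (op M) M.N M.tab } := by
  have h₁ : Computes (k := k) (.seq (setReg 7 (.lit 0)) (setReg 12 (.lit 0))) pre
      fun _ M => { M with x := 0, q := 0 } :=
    .of_loopFree ⟨trivial, trivial⟩ fun I M _ => by simp [den, NExpr.eval]
  have h₂ : Computes (k := k)
      (.seq P <| .seq (incr 7 Reg.x) <|
        .ite (.conj (.natLE (.add Reg.q (.lit 1)) Reg.w2) (.natLE Reg.w2 (.add Reg.q (.lit 1))))
          (setReg 12 (.lit 0)) (incr 12 Reg.q))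
      (fun I M => pre I M ∧ M.q = M.x % M.w2)
      fun _ M => { M with x := M.x + 1, q := (M.x + 1) % M.w2, tab := op M M.tab M.x } := by
    refine .of_loopFree ⟨hP, trivial, trivial, trivial⟩ fun I M hM => ?_
    rw [den, h I M hM.1 hM.2, succ_mod_eq_ite, ← hM.2]
    simp only [den, den_incr, Reg.eval_x, Mem.setNat_x, Test.Holds, NExpr.eval, Reg.eval_q,
      Reg.eval_w2, den_setReg, Mem.setNat_q, ← le_antisymm_iff]
    split_ifs <;> rfl
  refine (h₁.seq (h₂.loop (pre' := fun I M => pre I M ∧ M.x = 0 ∧ M.q = 0)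
    (g := fun _ M i => { M with x := i, q := i % M.w2, tab := Tab.sweep (op M) i M.tab })
    (c := fun _ M => M.N) (Polynomial.X ^ k) ?_ ?_ ?_ ?_) ?_).mono (fun _ _ h => h) ?_
  · rintro I M ⟨_, h1, h2⟩
    simp only [Nat.zero_mod, Tab.sweep]
    nth_rw 1 [← h1, ← h2]
  · rintro I M i ⟨hM, -, -⟩ hi
    refine ⟨⟨hpre' _ _ _ _ _ hM, rfl⟩, ?_, ?_⟩
    · simpa [Test.Holds, NExpr.eval] using hi
    · simp only [hop, Tab.sweep]
  · rintro I M _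
    simp [Test.Holds]
  · rintro I M ⟨hM, -, -⟩
    rw [hpre I M hM]
    simp only [Polynomial.eval_pow, Polynomial.eval_X]
    gcongr
    omega
  · exact fun I M hM => ⟨by simpa using hpre' I M 0 0 M.tab hM, rfl, rfl⟩
  · intro I M hM
    have := hop M 0 0 M.tab
    simp only [this]

/-- For every state `x`, open a transaction for the arc `j`: pay for the arc and copy the entry of
the cell `x` to the cell `N + x`. -/
def openArc (k : ℕ) : Program := (alloc k).sweep

/-- For every state `x`, close the transaction: keep the cheaper one of the entries of the cells
`x` and `N + x`. -/
def closeArc (k : ℕ) : Program := (relax k Reg.x (.add Reg.N Reg.x)).sweep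

/-- The multiplications `tw = tail * w`, `hw = head * w` and `w2 = n * w`. -/
def scale : Program :=
  .seq (.seq (setReg 7 (.lit 0)) <| .seq (setReg 9 (.lit 0)) <|
    .seq (setReg 10 (.lit 0)) (setReg 11 (.lit 0))) <|
  loopLT Reg.x Reg.n <|
    .seq (.ite (.natLE (.add Reg.x (.lit 1)) (.get 1 Reg.j)) (setReg 9 (.add Reg.tw Reg.w)) .skip) <|
    .seq (.ite (.natLE (.add Reg.x (.lit 1)) (.get 2 Reg.j)) (setReg 10 (.add Reg.hw Reg.w)) .skip) <|
    .seq (setReg 11 (.add Reg.w2 Reg.w)) (incr 7 Reg.x)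

/-- Within the transaction for the arc `j`, move the token of color `i` along the arc, if the arc
has this color, in every state in which the token is at the tail. -/
def moveToken (k i : ℕ) : Program :=
  -- the token is at the tail if and only if `tw ≤ q < tw + w`; then `tw ≤ x`, and the truncated
  -- subtraction is exact
  .seq scale <| .seq
    (sweep <| .ite (.conj (.natLE (.lit 1) (.get (3 + i) Reg.j))
        (.conj (.natLE Reg.tw Reg.q) (.neg (.natLE (.add Reg.tw Reg.w) Reg.q))))
      (relax k (.add Reg.N (.sub (.add Reg.x Reg.hw) Reg.tw)) (.add Reg.N Reg.x)) .skip)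
    (setReg 8 Reg.w2)

/-- Move the tokens of the colors below `i`; afterwards `w = n ^ i`. -/
def moveTokens (k : ℕ) : ℕ → Program
  | 0 => setReg 8 (.lit 1)
  | i + 1 => .seq (moveTokens k i) (moveToken k i)

/-- The step of the dynamic program for the arc `j`. -/
def processArc (k : ℕ) : Program :=
  .seq (openArc k) <| .seq (moveTokens k k) <| .seq (closeArc k) (incr 6 Reg.j)

/-- The effect of `openArc`. -/
noncomputable def openMem (M : Mem) : Mem :=
  { M with
    x := M.N, q := M.N % M.w2
    tab := Tab.sweep (fun T x => T.alloc M.j (max (M.c M.j) 0) (M.N + x) x) M.N M.tab }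

theorem computes_openArc (k : ℕ) : Computes (k := k) (openArc k) Ready fun _ M => openMem M :=
  computes_sweep (loopFree_alloc k)
    (fun M T x => T.alloc M.j (max (M.c M.j) 0) (M.N + x) x)
    (fun _ _ _ _ => rfl) (fun _ _ h => h.N) (fun _ _ _ _ _ h => { h with })
    fun _ M _ _ => den_alloc k M

/-- The effect of `closeArc`. -/
noncomputable def closeMem (M : Mem) : Mem :=
  { M with
    x := M.N, q := M.N % M.w2
    tab := Tab.sweep (fun T x => T.relax x (M.N + x)) M.N M.tab }

theorem computes_closeArc (k : ℕ) : Computes (k := k) (closeArc k) Ready fun _ M => closeMem M :=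
  computes_sweep (loopFree_relax k _ _) (fun M T x => T.relax x (M.N + x))
    (fun _ _ _ _ => rfl) (fun _ _ h => h.N) (fun _ _ _ _ _ h => { h with })
    fun _ M _ _ => den_relax k _ _ M

theorem computes_scale (k : ℕ) :
    Computes (k := k) scale (fun I M => Ready I M ∧ M.j < I.m) fun _ M =>
      { M with x := M.n, tw := M.a1 M.j * M.w, hw := M.a2 M.j * M.w, w2 := M.n * M.w } := by
  have h₁ : Computes (k := k) (.seq (setReg 7 (.lit 0)) <| .seq (setReg 9 (.lit 0)) <|
      .seq (setReg 10 (.lit 0)) (setReg 11 (.lit 0))) (fun I M => Ready I M ∧ M.j < I.m)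
      fun _ M => { M with x := 0, tw := 0, hw := 0, w2 := 0 } :=
    .of_loopFree ⟨trivial, trivial, trivial, trivial⟩ fun I M _ => by simp [den, NExpr.eval]
  have h₂ : Computes (k := k)
    (.seq (.ite (.natLE (.add Reg.x (.lit 1)) (.get 1 Reg.j)) (setReg 9 (.add Reg.tw Reg.w)) .skip) <|
    .seq (.ite (.natLE (.add Reg.x (.lit 1)) (.get 2 Reg.j)) (setReg 10 (.add Reg.hw Reg.w)) .skip) <|
    .seq (setReg 11 (.add Reg.w2 Reg.w)) (incr 7 Reg.x)) (fun _ _ => True)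
      fun _ M => { M with
        x := M.x + 1
        tw := if M.x + 1 ≤ M.a1 M.j then M.tw + M.w else M.tw
        hw := if M.x + 1 ≤ M.a2 M.j then M.hw + M.w else M.hw
        w2 := M.w2 + M.w } := by
    refine .of_loopFree ⟨⟨trivial, trivial⟩, ⟨trivial, trivial⟩, trivial, trivial⟩ fun I M _ => ?_
    by_cases ht : M.x + 1 ≤ M.a1 M.j <;> by_cases hh : M.x + 1 ≤ M.a2 M.j <;>
      simp [den, NExpr.eval, Test.Holds, ht, hh]
  have hmin : ∀ i d w : ℕ, (if i + 1 ≤ d then min i d * w + w else min i d * w)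
      = min (i + 1) d * w := by
    intro i d w
    split_ifs with h
    · rw [min_eq_left (by omega), min_eq_left h, Nat.succ_mul]
    · rw [min_eq_right (by omega), min_eq_right (by omega)]
  refine (h₁.seq (h₂.loop (pre' := fun I M => (Ready I M ∧ M.j < I.m) ∧ M.x = 0 ∧ M.tw = 0 ∧
      M.hw = 0 ∧ M.w2 = 0)
    (g := fun _ M i => { M with
      x := i, tw := min i (M.a1 M.j) * M.w, hw := min i (M.a2 M.j) * M.w, w2 := i * M.w })
    (c := fun _ M => M.n) Polynomial.X ?_ ?_ ?_ ?_) ?_).mono (fun _ _ h => h) ?_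
  · rintro I M ⟨_, h⟩
    obtain ⟨⟩ := M
    simp_all
  · rintro I M i _ hi
    refine ⟨trivial, ?_, ?_⟩
    · simpa [Test.Holds, NExpr.eval] using hi
    · simp only [hmin, Nat.succ_mul]
  · rintro I M _
    simp [Test.Holds]
  · rintro I M ⟨⟨hM, -⟩, -⟩
    simp [hM.n]
  · exact fun I M hM => ⟨⟨{ hM.1 with }, hM.2⟩, rfl, rfl, rfl, rfl⟩
  · rintro I M ⟨hM, hj⟩
    have h1 : M.a1 M.j ≤ M.n := by
      rw [hM.n, hM.a1 ⟨M.j, hj⟩]; exact (I.tail _).2.le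
    have h2 : M.a2 M.j ≤ M.n := by
      rw [hM.n, hM.a2 ⟨M.j, hj⟩]; exact (I.head _).2.le
    simp only [min_eq_right h1, min_eq_right h2]

/-- The effect of `moveToken`. -/
noncomputable def moveTokenMem (i : ℕ) (M : Mem) : Mem :=
  { M with
    x := M.N, q := M.N % (M.n * M.w), tw := M.a1 M.j * M.w, hw := M.a2 M.j * M.w
    w2 := M.n * M.w, w := M.n * M.w
    tab := Tab.sweep (Tab.move (M.col i M.j ≠ 0) M.N M.n M.w (M.a1 M.j) (M.a2 M.j)) M.N M.tab }

theorem computes_moveToken {k i : ℕ} (hi : i < k) :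
    Computes (k := k) (moveToken k i) (fun I M => Ready I M ∧ M.j < I.m ∧ 0 < M.w)
      fun _ M => moveTokenMem i M := by
  have h₁ := (computes_scale k).mono (pre' := fun I M => Ready I M ∧ M.j < I.m ∧ 0 < M.w)
    (fun _ _ h => ⟨h.1, h.2.1⟩) fun _ _ _ => rfl
  have h₂ := computes_sweep (k := k)
    (pre := fun I M => (Ready I M ∧ M.j < I.m ∧ 0 < M.w) ∧
      M.tw = M.a1 M.j * M.w ∧ M.hw = M.a2 M.j * M.w ∧ M.w2 = M.n * M.w)
    (P := .ite (.conj (.natLE (.lit 1) (.get (3 + i) Reg.j))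
        (.conj (.natLE Reg.tw Reg.q) (.neg (.natLE (.add Reg.tw Reg.w) Reg.q))))
      (relax k (.add Reg.N (.sub (.add Reg.x Reg.hw) Reg.tw)) (.add Reg.N Reg.x)) .skip)
    ⟨loopFree_relax _ _ _, trivial⟩
    (fun M => Tab.move (M.col i M.j ≠ 0) M.N M.n M.w (M.a1 M.j) (M.a2 M.j))
    (fun _ _ _ _ => rfl) (fun _ _ h => h.1.1.N)
    (fun _ _ _ _ _ h => ⟨⟨{ h.1.1 with }, h.1.2⟩, h.2⟩)
    (by
      rintro I M ⟨⟨hM, hj, hw⟩, htw, hhw, hw2⟩ hq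
      have hcol := Mem.toStore_nat_col k M ⟨i, hi⟩ M.j
      simp only at hcol
      have key : (M.tw ≤ M.q ∧ ¬ M.tw + M.w ≤ M.q) ↔ M.x / M.w % M.n = M.a1 M.j := by
        rw [hq, hw2, htw, Nat.mul_comm M.n, ← Nat.mod_mul_right_div_self,
          Nat.div_eq_iff hw]
        omega
      simp only [den, Test.Holds, NExpr.eval, Reg.eval_j, hcol, Reg.eval_tw, Reg.eval_q,
        Reg.eval_w, key, Nat.one_le_iff_ne_zero, Tab.move, den_relax, Reg.eval_N, Reg.eval_x,
        Reg.eval_hw, ← htw, ← hhw]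
      split_ifs <;> rfl)
  have h₃ : Computes (k := k) (setReg 8 Reg.w2) (fun _ _ => True) fun _ M => { M with w := M.w2 } :=
    .of_loopFree trivial fun I M _ => by simp
  refine (h₁.seq (h₂.seq h₃ fun _ _ _ => trivial) ?_).mono
    (fun _ _ h => h) fun _ _ _ => rfl
  exact fun I M hM => ⟨⟨{ hM.1 with }, hM.2⟩, rfl, rfl, rfl⟩

end Program

/-! ### The dynamic program as a sequence of operations on the table -/

namespace SimInstance

variable {k : ℕ} (I : SimInstance k)

/-- The positive part of the cost of an arc. -/
noncomputable def price (a : Fin I.m) : ℝ := max (I.cost a) 0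

/-- Open a transaction for the arc `a` in every state. -/
noncomputable def openTab (a : Fin I.m) (T : Tab) : Tab :=
  Tab.sweep (fun T x => T.alloc a (I.price a) (I.n ^ k + x) x) (I.n ^ k) T

/-- Move the token of color `i` along the arc `a`, where this is possible. -/
noncomputable def moveTab (a : Fin I.m) (T : Tab) (i : ℕ) : Tab :=
  Tab.sweep (Tab.move (∃ h : i < k, a ∈ I.color ⟨i, h⟩) (I.n ^ k) I.n (I.n ^ i) (I.tail a)
    (I.head a)) (I.n ^ k) T

/-- Close the transaction in every state. -/
noncomputable def closeTab (T : Tab) : Tab :=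
  Tab.sweep (fun T x => T.relax x (I.n ^ k + x)) (I.n ^ k) T

/-- The step of the dynamic program for the arc `a`. -/
noncomputable def arcTab (a : Fin I.m) (T : Tab) : Tab :=
  I.closeTab (Tab.sweep (I.moveTab a) k (I.openTab a T))

/-- A round of the dynamic program: one step for each arc. -/
noncomputable def roundTab (T : Tab) : Tab :=
  Tab.sweep (fun T j => if h : j < I.m then I.arcTab ⟨j, h⟩ T else T) I.m T

/-- The state in which all tokens are at `u`. -/
def diag (u : Fin I.n) : ℕ := ∑ i ∈ Finset.range k, u * I.n ^ i

/-- Initially the node `1` (the empty set) is entered at the state with all tokens at `s`. -/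
noncomputable def startTab : Tab where
  F := Function.update (fun _ => 0) (I.diag I.s) 1
  prev := fun _ => 0
  arc := fun _ => 0
  cost := fun _ => 0
  cnt := 2

/-- The table after `n` rounds. -/
noncomputable def finalTab : Tab := Tab.sweep (fun T _ => I.roundTab T) I.n I.startTab

/-- An upper bound for the number of nodes of the table. -/
def maxNodes : ℕ :=
  2 + I.n * (I.m * I.n ^ k)

theorem n_pos : 0 < I.n := I.s.pos

end SimInstance

namespace Program

/-! ### The loops over the arcs and the rounds -/

/-- The effect of `moveTokens`. -/
noncomputable def moveTokensMem : ℕ → Mem → Mem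
  | 0, M => { M with w := 1 }
  | i + 1, M => moveTokenMem i (moveTokensMem i M)

theorem moveTokensMem_spec {k : ℕ} {I : SimInstance k} {M : Mem} (hM : Ready I M)
    (hj : M.j < I.m) {i : ℕ} (hi : i ≤ k) :
    Ready I (moveTokensMem i M) ∧ (moveTokensMem i M).j = M.j ∧ (moveTokensMem i M).r = M.r ∧
      (moveTokensMem i M).w = I.n ^ i ∧
      (moveTokensMem i M).tab = Tab.sweep (I.moveTab ⟨M.j, hj⟩) i M.tab := by
  induction i with
  | zero => exact ⟨{ hM with }, rfl, rfl, rfl, rfl⟩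
  | succ i ih =>
    obtain ⟨h, h₁, h₂, h₃, h₄⟩ := ih (by omega)
    refine ⟨{ h with }, h₁, h₂, ?_, ?_⟩
    · simp only [moveTokensMem, moveTokenMem, h₃, h.n, pow_succ']
    · have hcol := h.col ⟨i, hi⟩ ⟨M.j, hj⟩
      have hp : ((moveTokensMem i M).col i M.j ≠ 0) =
          ∃ h : i < k, (⟨M.j, hj⟩ : Fin I.m) ∈ I.color ⟨i, h⟩ := by
        simp only at hcol
        simp [hcol, show i < k from hi]
      have h1 := h.a1 ⟨M.j, hj⟩
      have h2 := h.a2 ⟨M.j, hj⟩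
      simp only at h1 h2
      simp only [moveTokensMem, moveTokenMem, Tab.sweep, h₁, h₃, h₄, h.n, h.N, hp, h1, h2,
        SimInstance.moveTab]

theorem computes_moveTokens (k : ℕ) {i : ℕ} (hi : i ≤ k) :
    Computes (k := k) (moveTokens k i) (fun I M => Ready I M ∧ M.j < I.m)
      fun _ M => moveTokensMem i M := by
  induction i with
  | zero => exact .of_loopFree trivial fun I M _ => by simp [moveTokens, moveTokensMem, NExpr.eval]
  | succ i ih =>
    refine (ih (by omega)).seq (computes_moveToken hi) fun I M hM => ?_
    obtain ⟨h, h₁, -, h₃, -⟩ := moveTokensMem_spec hM.1 hM.2 (i := i) (by omega)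
    exact ⟨h, h₁ ▸ hM.2, h₃ ▸ Nat.pow_pos I.n_pos⟩

/-- The effect of `processArc`. -/
noncomputable def processMem (k : ℕ) (M : Mem) : Mem :=
  { closeMem (moveTokensMem k (openMem M)) with j := M.j + 1 }

theorem processMem_spec {k : ℕ} {I : SimInstance k} {M : Mem} (hM : Ready I M) (hj : M.j < I.m) :
    Ready I (processMem k M) ∧ (processMem k M).r = M.r ∧
      (processMem k M).tab = I.arcTab ⟨M.j, hj⟩ M.tab := by
  obtain ⟨h, -, h₂, -, h₄⟩ := moveTokensMem_spec (I := I) (M := openMem M) { hM with } hj le_rfl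
  refine ⟨{ h with }, h₂, ?_⟩
  have hc := hM.c ⟨M.j, hj⟩
  simp only at hc
  simp only [processMem, closeMem, h.N, h₄, SimInstance.arcTab, SimInstance.closeTab]
  simp only [openMem, hM.N, hc, SimInstance.openTab, SimInstance.price]

theorem computes_processArc (k : ℕ) :
    Computes (k := k) (processArc k) (fun I M => Ready I M ∧ M.j < I.m)
      fun _ M => processMem k M := by
  have h : Computes (k := k) (incr 6 Reg.j) (fun _ _ => True) fun _ M => { M with j := M.j + 1 } :=
    .of_loopFree trivial fun I M _ => by simp
  have h₁ := (computes_openArc k).mono (pre' := fun I M => Ready I M ∧ M.j < I.m)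
    (fun _ _ h => h.1) fun _ _ _ => rfl
  have h₂ := (computes_moveTokens k le_rfl).mono (pre' := fun I M => Ready I M ∧ M.j < I.m)
    (fun _ _ h => h) fun _ _ _ => rfl
  refine (h₁.seq (h₂.seq ((computes_closeArc k).seq h fun _ _ _ => trivial) ?_) ?_).mono
    (fun _ _ h => h) ?_
  · exact fun I M hM => (moveTokensMem_spec hM.1 hM.2 le_rfl).1
  · exact fun I M hM => ⟨{ hM.1 with }, hM.2⟩
  · intro I M hM
    have := (moveTokensMem_spec (I := I) (M := openMem M) { hM.1 with } hM.2 le_rfl).2.1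
    simp only [this, processMem, closeMem]
    rfl

/-- The loop over the arcs. -/
def roundProg (k : ℕ) : Program :=
  .seq (setReg 6 (.lit 0)) <| .seq (loopLT Reg.j Reg.m (processArc k)) (incr 5 Reg.r)

/-- The effect of `roundProg`. -/
noncomputable def roundMem (k : ℕ) (M : Mem) : Mem :=
  let M' := (processMem k)^[M.m] { M with j := 0 }
  { M' with r := M'.r + 1 }

theorem computes_roundProg (k : ℕ) :
    Computes (k := k) (roundProg k) Ready (fun _ M => roundMem k M) ∧
      ∀ (I : SimInstance k) M, Ready I M → Ready I (roundMem k M) ∧ (roundMem k M).r = M.r + 1 ∧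
        (roundMem k M).tab = I.roundTab M.tab := by
  have h₁ : Computes (k := k) (setReg 6 (.lit 0)) Ready fun _ M => { M with j := 0 } :=
    .of_loopFree trivial fun I M _ => by simp [NExpr.eval]
  have h₃ : Computes (k := k) (incr 5 Reg.r) (fun _ _ => True) fun _ M => { M with r := M.r + 1 } :=
    .of_loopFree trivial fun I M _ => by simp
  obtain ⟨h₂, h₂'⟩ := (computes_processArc k).loop_iterate
    (b := .neg (.natLE Reg.m Reg.j)) (pre' := fun I M => Ready I M ∧ M.j = 0)
    (fun I M i M' => Ready I M' ∧ M'.j = i ∧ M'.r = M.r ∧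
      M'.tab = Tab.sweep (fun T j => if h : j < I.m then I.arcTab ⟨j, h⟩ T else T) i M.tab)
    (c := fun _ M => M.m) Polynomial.X
    (fun I M hM => ⟨hM.1, hM.2, rfl, rfl⟩)
    (by
      rintro I M i M' ⟨hM, -⟩ hi ⟨hM', rfl, hr, ht⟩
      rw [hM.m] at hi
      obtain ⟨h, h₁, h₂⟩ := processMem_spec hM' hi
      refine ⟨⟨hM', hi⟩, ?_, h, rfl, h₁.trans hr, ?_⟩
      · simpa [Test.Holds, hM'.m] using hi
      · rw [h₂, Tab.sweep, dif_pos hi, ht])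
    (by
      rintro I M M' ⟨hM, -⟩ ⟨hM', hj, -⟩
      simp [Test.Holds, hj, hM.m, hM'.m])
    (fun I M hM => by simp [hM.1.m])
  refine ⟨(h₁.seq (h₂.seq h₃ fun _ _ _ => trivial) ?_).mono (fun _ _ h => h) fun _ _ _ => rfl, ?_⟩
  · exact fun I M hM => ⟨{ hM with }, rfl⟩
  · intro I M hM
    obtain ⟨h, -, hr, ht⟩ := h₂' I { M with j := 0 } ⟨{ hM with }, rfl⟩
    refine ⟨{ h with }, congrArg (· + 1) hr, ?_⟩
    simp only [hM.m] at ht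
    simp only [roundMem, hM.m, ht, SimInstance.roundTab]

/-- The loop over the rounds. -/
def roundsProg (k : ℕ) : Program := loopLT Reg.r Reg.n (roundProg k)

theorem computes_roundsProg (k : ℕ) :
    Computes (k := k) (roundsProg k) (fun I M => Ready I M ∧ M.r = 0)
        (fun _ M => (roundMem k)^[M.n] M) ∧
      ∀ (I : SimInstance k) M, Ready I M ∧ M.r = 0 → Ready I ((roundMem k)^[M.n] M) ∧
        ((roundMem k)^[M.n] M).tab = Tab.sweep (fun T _ => I.roundTab T) I.n M.tab := by
  obtain ⟨h, h'⟩ := computes_roundProg k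
  obtain ⟨h₂, h₂'⟩ := h.loop_iterate
    (b := .neg (.natLE Reg.n Reg.r)) (pre' := fun I M => Ready I M ∧ M.r = 0)
    (fun I M i M' => Ready I M' ∧ M'.r = i ∧
      M'.tab = Tab.sweep (fun T _ => I.roundTab T) i M.tab)
    (c := fun _ M => M.n) Polynomial.X
    (fun I M hM => ⟨hM.1, hM.2, rfl⟩)
    (by
      rintro I M i M' ⟨hM, -⟩ hi ⟨hM', rfl, ht⟩
      obtain ⟨g, g₁, g₂⟩ := h' I M' hM'
      refine ⟨hM', ?_, g, g₁, ?_⟩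
      · rw [hM.n, ← hM'.n] at hi
        simpa [Test.Holds] using hi
      · rw [g₂, Tab.sweep, ht])
    (by
      rintro I M M' ⟨hM, -⟩ ⟨hM', hr, -⟩
      simp [Test.Holds, hr, hM.n, hM'.n])
    (fun I M hM => by simp [hM.1.n])
  refine ⟨h₂, fun I M hM => ?_⟩
  obtain ⟨g, -, g₂⟩ := h₂' I M hM
  exact ⟨g, g₂.trans (by rw [hM.1.n])⟩

/-! ### Preparation -/

/-- One step of Horner's scheme for `N = n ^ k` and for the two states with all tokens at `s` and
at `t`. -/
def horner : Program :=
  .seq (.seq (setReg 7 (.lit 0)) <| .seq (setReg 9 (.lit 0)) <|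
    .seq (setReg 10 (.lit 0)) (setReg 11 (.lit 0))) <|
  .seq (loopLT Reg.x Reg.n <| .seq (setReg 9 (.add Reg.tw Reg.xs)) <|
    .seq (setReg 10 (.add Reg.hw Reg.xt)) <| .seq (setReg 11 (.add Reg.w2 Reg.N)) (incr 7 Reg.x)) <|
  .seq (setReg 13 (.add Reg.tw Reg.s)) <| .seq (setReg 14 (.add Reg.hw Reg.t)) (setReg 4 Reg.w2)

/-- The effect of `horner`. -/
def hornerMem (M : Mem) : Mem :=
  { M with
    x := M.n, tw := M.n * M.xs, hw := M.n * M.xt, w2 := M.n * M.N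
    xs := M.n * M.xs + M.s, xt := M.n * M.xt + M.t, N := M.n * M.N }

theorem computes_horner (k : ℕ) :
    Computes (k := k) horner (fun I M => M.n = I.n) fun _ M => hornerMem M := by
  have h₁ : Computes (k := k) (.seq (setReg 7 (.lit 0)) <| .seq (setReg 9 (.lit 0)) <|
      .seq (setReg 10 (.lit 0)) (setReg 11 (.lit 0))) (fun I M => M.n = I.n)
      fun _ M => { M with x := 0, tw := 0, hw := 0, w2 := 0 } :=
    .of_loopFree ⟨trivial, trivial, trivial, trivial⟩ fun I M _ => by simp [den, NExpr.eval]
  have h₂ : Computes (k := k) (.seq (setReg 9 (.add Reg.tw Reg.xs)) <|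
      .seq (setReg 10 (.add Reg.hw Reg.xt)) <| .seq (setReg 11 (.add Reg.w2 Reg.N)) (incr 7 Reg.x))
      (fun _ _ => True) fun _ M =>
        { M with x := M.x + 1, tw := M.tw + M.xs, hw := M.hw + M.xt, w2 := M.w2 + M.N } :=
    .of_loopFree ⟨trivial, trivial, trivial, trivial⟩ fun I M _ => by simp [den, NExpr.eval]
  have h₃ : Computes (k := k) (.seq (setReg 13 (.add Reg.tw Reg.s)) <|
      .seq (setReg 14 (.add Reg.hw Reg.t)) (setReg 4 Reg.w2))
      (fun _ _ => True) fun _ M =>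
        { M with xs := M.tw + M.s, xt := M.hw + M.t, N := M.w2 } :=
    .of_loopFree ⟨trivial, trivial, trivial⟩ fun I M _ => by simp [den, NExpr.eval]
  refine (h₁.seq ((h₂.loop (pre' := fun I M => M.n = I.n ∧ M.x = 0 ∧ M.tw = 0 ∧
      M.hw = 0 ∧ M.w2 = 0)
    (g := fun _ M i => { M with x := i, tw := i * M.xs, hw := i * M.xt, w2 := i * M.N })
    (c := fun _ M => M.n) Polynomial.X ?_ ?_ ?_ ?_).seq h₃ fun _ _ _ => trivial) ?_).mono
      (fun _ _ h => h) fun _ _ _ => rfl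
  · rintro I M ⟨_, h⟩
    obtain ⟨⟩ := M
    simp_all
  · rintro I M i _ hi
    refine ⟨trivial, ?_, ?_⟩
    · simpa [Test.Holds, NExpr.eval] using hi
    · simp only [Nat.succ_mul]
  · rintro I M _
    simp [Test.Holds]
  · rintro I M ⟨hM, -⟩
    simp [hM]
  · exact fun I M hM => ⟨hM, rfl, rfl, rfl, rfl⟩

/-- Horner's scheme. -/
def hornerProg : ℕ → Program
  | 0 => setReg 4 (.lit 1)
  | i + 1 => .seq (hornerProg i) horner

/-- The effect of `hornerProg`. -/
def hornerProgMem : ℕ → Mem → Mem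
  | 0, M => { M with N := 1 }
  | i + 1, M => hornerMem (hornerProgMem i M)

theorem computes_hornerProg (k i : ℕ) :
    Computes (k := k) (hornerProg i) (fun I M => M.n = I.n) (fun _ M => hornerProgMem i M) ∧
      ∀ M : Mem, (hornerProgMem i M).n = M.n := by
  induction i with
  | zero => exact ⟨.of_loopFree trivial fun I M _ => by simp [hornerProgMem, NExpr.eval, hornerProg],
      fun _ => rfl⟩
  | succ i ih => exact ⟨ih.1.seq (computes_horner k) fun I M hM => (ih.2 M).trans hM, ih.2⟩

theorem hornerProgMem_spec {i : ℕ} {M : Mem} (hs : M.xs = 0) (ht : M.xt = 0) :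
    ∃ x tw hw w2, hornerProgMem i M = { M with
      x := x, tw := tw, hw := hw, w2 := w2, N := M.n ^ i
      xs := ∑ j ∈ Finset.range i, M.s * M.n ^ j, xt := ∑ j ∈ Finset.range i, M.t * M.n ^ j } := by
  induction i with
  | zero =>
    refine ⟨M.x, M.tw, M.hw, M.w2, ?_⟩
    simp only [hornerProgMem, pow_zero, Finset.range_zero, Finset.sum_empty]
    nth_rw 1 [hs, ht]
  | succ i ih =>
    obtain ⟨x, tw, hw, w2, h⟩ := ih
    have hsum : ∀ u, M.n * ∑ j ∈ Finset.range i, u * M.n ^ j + u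
        = ∑ j ∈ Finset.range (i + 1), u * M.n ^ j := by
      intro u
      rw [Finset.sum_range_succ', Finset.mul_sum, pow_zero, mul_one]
      congr 1
      refine Finset.sum_congr rfl fun j _ => ?_
      ring
    rw [hornerProgMem, h]
    simp only [hornerMem, hsum, ← pow_succ']
    exact ⟨_, _, _, _, rfl⟩

/-- The preparation: Horner's scheme, and the initial entry of the table. -/
def prepare (k : ℕ) : Program :=
  .seq (hornerProg k) <| .seq (.setNat (3 + k) Reg.xs (.lit 1)) (setReg 16 (.lit 2))

/-- The initial memory. -/
noncomputable def inputMem {k : ℕ} (I : SimInstance k) : Mem where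
  n := I.n
  m := I.m
  s := I.s
  t := I.t
  N := 0
  r := 0
  j := 0
  x := 0
  w := 0
  tw := 0
  hw := 0
  w2 := 0
  q := 0
  xs := 0
  xt := 0
  id := 0
  a1 j := if h : j < I.m then I.tail ⟨j, h⟩ else 0
  a2 j := if h : j < I.m then I.head ⟨j, h⟩ else 0
  col i j := if hi : i < k then if hj : j < I.m then
    if (⟨j, hj⟩ : Fin I.m) ∈ I.color ⟨i, hi⟩ then 1 else 0 else 0 else 0
  c j := if h : j < I.m then I.cost ⟨j, h⟩ else 0
  tab := ⟨fun _ => 0, fun _ => 0, fun _ => 0, fun _ => 0, 0⟩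

theorem toStore_inputMem {k : ℕ} (I : SimInstance k) : (inputMem I).toStore k = I.input := by
  simp only [Mem.toStore, SimInstance.input]
  congr 1
  · funext b j
    by_cases h0 : b = 0
    · simp only [h0, if_true, Mem.regs, inputMem]
      split_ifs with h h h h
      · subst h; rfl
      · subst h; rfl
      · subst h; rfl
      · subst h; rfl
      · obtain ⟨j, rfl⟩ : ∃ l, j = l + 4 := ⟨j - 4, by omega⟩
        simp only [List.getD_cons_succ]
        by_cases hj : j < 13
        · interval_cases j <;> rfl
        · exact List.getD_eq_default _ _ (by simpa using hj)
    · by_cases hj : j < I.m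
      · simp only [h0, if_false, inputMem, hj, dif_pos]
        split_ifs <;> first | rfl | omega
      · simp [h0, hj, inputMem]
  · funext b j
    simp [inputMem]

theorem computes_prepare (k : ℕ) :
    ∃ f : SimInstance k → Mem → Mem,
      Computes (k := k) (prepare k) (fun I M => M = inputMem I) f ∧
      ∀ I : SimInstance k, Ready I (f I (inputMem I)) ∧ (f I (inputMem I)).r = 0 ∧
        (f I (inputMem I)).tab = I.startTab := by
  have h : Computes (k := k) (.seq (.setNat (3 + k) Reg.xs (.lit 1)) (setReg 16 (.lit 2)))
      (fun _ _ => True) fun _ M =>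
        { M with tab := { M.tab with F := Function.update M.tab.F M.xs 1, cnt := 2 } } :=
    .of_loopFree ⟨trivial, trivial⟩ fun I M _ => by simp [den, NExpr.eval]
  refine ⟨_, ((computes_hornerProg k k).1.mono (fun I M (hM : M = inputMem I) => by rw [hM]; rfl)
    fun _ _ _ => rfl).seq h fun _ _ _ => trivial, fun I => ?_⟩
  obtain ⟨x, tw, hw, w2, h⟩ := hornerProgMem_spec (i := k) (M := inputMem I) rfl rfl
  rw [h]
  refine ⟨⟨rfl, rfl, ?_, ?_, ?_, ?_, rfl, rfl, rfl⟩, rfl, rfl⟩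
  all_goals simp [inputMem]

/-! ### The output -/

/-- Mark the arcs of negative cost. -/
def markNegative : Program :=
  .seq (setReg 6 (.lit 0)) <| loopLT Reg.j Reg.m <|
    .seq (.ite (.realLE .zero (.get 0 Reg.j)) (.setNat 1 Reg.j (.lit 0)) (.setNat 1 Reg.j (.lit 1)))
      (incr 6 Reg.j)

open Classical in
theorem computes_markNegative (k : ℕ) :
    Computes (k := k) markNegative (fun I M => M.m = I.m) fun _ M =>
      { M with j := M.m, a1 := fun a => if a < M.m then if 0 ≤ M.c a then 0 else 1 else M.a1 a } := by
  have h₁ : Computes (k := k) (setReg 6 (.lit 0)) (fun I M => M.m = I.m)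
      fun _ M => { M with j := 0 } :=
    .of_loopFree trivial fun I M _ => by simp [NExpr.eval]
  have h₂ : Computes (k := k) (.seq (.ite (.realLE .zero (.get 0 Reg.j))
      (.setNat 1 Reg.j (.lit 0)) (.setNat 1 Reg.j (.lit 1))) (incr 6 Reg.j)) (fun _ _ => True)
      fun _ M => { M with
        j := M.j + 1, a1 := Function.update M.a1 M.j (if 0 ≤ M.c M.j then 0 else 1) } := by
    refine .of_loopFree ⟨⟨trivial, trivial⟩, trivial⟩ fun I M _ => ?_
    by_cases h : 0 ≤ M.c M.j <;> simp [den, Test.Holds, RExpr.eval, NExpr.eval, h]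
  refine (h₁.seq (h₂.loop (pre' := fun I M => M.m = I.m ∧ M.j = 0)
    (g := fun _ M i => { M with
      j := i, a1 := fun a => if a < i then if 0 ≤ M.c a then 0 else 1 else M.a1 a })
    (c := fun _ M => M.m) Polynomial.X ?_ ?_ ?_ ?_) ?_).mono (fun _ _ h => h) fun _ _ _ => rfl
  · rintro I M ⟨_, h⟩
    obtain ⟨⟩ := M
    simp_all
  · rintro I M i _ hi
    refine ⟨trivial, ?_, ?_⟩
    · simpa [Test.Holds] using hi
    · congr 1
      funext a
      rcases lt_trichotomy a i with h | h | h
      · simp [h, h.ne, show a < i + 1 by omega]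
      · simp [h]
      · simp [h.ne', show ¬ a < i by omega, show ¬ a < i + 1 by omega]
  · rintro I M _
    simp [Test.Holds]
  · rintro I M ⟨hM, -⟩
    simp [hM]
  · exact fun I M hM => ⟨hM, rfl⟩

/-- Mark the arcs of the node `id`. -/
def markNode (k : ℕ) : Program :=
  .seq (setReg 7 (.lit 0)) <| loopLT Reg.x Reg.cnt <|
    .seq (.ite (.natLE (.lit 2) Reg.id)
      (.seq (.setNat 1 (.get (5 + k) Reg.id) (.lit 1)) (setReg 15 (.get (4 + k) Reg.id))) .skip)
      (incr 7 Reg.x)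

theorem computes_markNode (k : ℕ) :
    ∃ f : SimInstance k → Mem → Mem,
      Computes (k := k) (markNode k) (fun I M => M.tab.cnt ≤ I.maxNodes) f ∧
      ∀ I M, M.tab.cnt ≤ I.maxNodes →
        (f I M).tab = M.tab ∧ (f I M).xt = M.xt ∧
        ∀ G : ℕ → Finset (Fin I.m), M.tab.Chain G → M.id < M.tab.cnt →
          ∀ a : Fin I.m, (f I M).a1 a = 1 ↔ M.a1 a = 1 ∨ a ∈ G M.id := by
  have h₁ : Computes (k := k) (setReg 7 (.lit 0)) (fun I M => M.tab.cnt ≤ I.maxNodes)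
      fun _ M => { M with x := 0 } :=
    .of_loopFree trivial fun I M _ => by simp [NExpr.eval]
  have h₂ : Computes (k := k) (.seq (.ite (.natLE (.lit 2) Reg.id)
      (.seq (.setNat 1 (.get (5 + k) Reg.id) (.lit 1)) (setReg 15 (.get (4 + k) Reg.id))) .skip)
      (incr 7 Reg.x)) (fun _ _ => True) fun _ M => if 2 ≤ M.id then
        { M with x := M.x + 1, a1 := Function.update M.a1 (M.tab.arc M.id) 1, id := M.tab.prev M.id }
        else { M with x := M.x + 1 } := by
    refine .of_loopFree ⟨⟨⟨trivial, trivial⟩, trivial⟩, trivial⟩ fun I M _ => ?_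
    by_cases h : 2 ≤ M.id <;> simp [den, Test.Holds, NExpr.eval, h]
  obtain ⟨h₃, h₃'⟩ := h₂.loop_iterate (b := .neg (.natLE Reg.cnt Reg.x))
    (pre' := fun I M => M.tab.cnt ≤ I.maxNodes ∧ M.x = 0)
    (fun I M i M' => M'.x = i ∧ M'.tab = M.tab ∧ M'.xt = M.xt ∧
      ∀ G : ℕ → Finset (Fin I.m), M.tab.Chain G → M.id < M.tab.cnt →
        (M'.id < 2 ∨ M'.id + i ≤ M.id) ∧
        ∀ a : Fin I.m, (M'.a1 a = 1 ∨ a ∈ G M'.id) ↔ (M.a1 a = 1 ∨ a ∈ G M.id))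
    (c := fun _ M => M.tab.cnt)
    (2 + Polynomial.X * (Polynomial.X * Polynomial.X ^ k))
    (fun I M hM => ⟨hM.2, rfl, rfl, fun G _ _ => ⟨.inr le_rfl, fun _ => Iff.rfl⟩⟩)
    (by
      rintro I M i M' - hi ⟨rfl, ht, hxt, h⟩
      refine ⟨trivial, by simpa [Test.Holds, ht] using hi, ?_⟩
      split_ifs with hid
      · refine ⟨rfl, ht, hxt, fun G hG hid' => ?_⟩
        obtain ⟨h1, h2⟩ := h G hG hid'
        have hlt : M'.id < M.tab.cnt := by omega
        have hprev := hG.prev_lt _ hid hlt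
        obtain ⟨b, hb, hb'⟩ := hG.insert _ hid hlt
        rw [ht]
        refine ⟨.inr (by simp only; omega), fun a => ?_⟩
        simp only [← h2 a, hb', ← hb, Finset.mem_insert, Function.update_apply, ← Fin.ext_iff]
        by_cases hab : a = b <;> simp [hab]
      · refine ⟨rfl, ht, hxt, fun G hG hid' => ?_⟩
        obtain ⟨h1, h2⟩ := h G hG hid'
        exact ⟨.inl (by simp only; omega), h2⟩)
    (by
      rintro I M M' - ⟨hx, ht, -⟩
      simp [Test.Holds, hx, ht])
    (by
      rintro I M ⟨hM, -⟩
      refine hM.trans ?_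
      simp only [SimInstance.maxNodes, Polynomial.eval_add, Polynomial.eval_mul,
        Polynomial.eval_X, Polynomial.eval_pow, Polynomial.eval_ofNat]
      gcongr <;> omega)
  refine ⟨_, h₁.seq h₃ fun I M hM => ⟨hM, rfl⟩, fun I M hM => ?_⟩
  obtain ⟨-, ht, hxt, h⟩ := h₃' I { M with x := 0 } ⟨hM, rfl⟩
  refine ⟨ht, hxt, fun G hG hid a => ?_⟩
  obtain ⟨h1, h2⟩ := h G hG hid
  rw [← h2 a, hG.empty _ (h1.resolve_right fun h1 =>
    ((Nat.le_add_left M.tab.cnt _).trans h1).not_gt hid)]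
  exact (or_iff_left (Finset.notMem_empty a)).symm

/-- The whole algorithm. The verdict is read off from the entry of the final state. -/
def main (k : ℕ) : Program :=
  .seq (prepare k) <| .seq (roundsProg k) <| .seq (setReg 15 (Reg.xt.F k)) <|
  .seq markNegative <| .seq (markNode k) <|
  .ite (Reg.xt.F k).isPos (setReg 0 (.lit 1)) (setReg 0 (.lit 0))

/-- The program halts in polynomial time, and its output is the entry of the table at the final
state with all tokens at `t`, together with the arcs of negative cost. -/
theorem main_spec (k : ℕ) : ∃ p : Polynomial ℕ, ∀ I : SimInstance k,
    I.finalTab.cnt ≤ I.maxNodes → ∃ T σ, Runs (main k) I.input T σ ∧ T ≤ p.eval (I.n + I.m) ∧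
      (σ.nat 0 0 = if I.finalTab.F (I.diag I.t) = 0 then 0 else 1) ∧
      ∀ G : ℕ → Finset (Fin I.m), I.finalTab.Chain G →
        I.finalTab.F (I.diag I.t) < I.finalTab.cnt →
        ∀ a : Fin I.m, σ.nat 1 a = 1 ↔ I.cost a < 0 ∨ a ∈ G (I.finalTab.F (I.diag I.t)) := by
  obtain ⟨f₁, h₁, h₁'⟩ := computes_prepare k
  obtain ⟨h₂, h₂'⟩ := computes_roundsProg k
  have h₃ : Computes (k := k) (setReg 15 (Reg.xt.F k)) (fun I M => Ready I M ∧ M.tab = I.finalTab ∧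
      I.finalTab.cnt ≤ I.maxNodes) fun _ M => { M with id := M.tab.F M.xt } :=
    .of_loopFree trivial fun I M _ => by simp
  have h₄ := computes_markNegative k
  obtain ⟨f₅, h₅, h₅'⟩ := computes_markNode k
  have h₆ : Computes (k := k) (.ite (Reg.xt.F k).isPos (setReg 0 (.lit 1)) (setReg 0 (.lit 0)))
      (fun _ _ => True) fun _ M => { M with n := if M.tab.F M.xt = 0 then 0 else 1 } :=
    .of_loopFree ⟨trivial, trivial⟩ fun I M _ => by
      by_cases h : M.tab.F M.xt = 0 <;> simp [den, NExpr.eval, h]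
  have key := (h₁.mono (pre' := fun I M => M = inputMem I ∧ I.finalTab.cnt ≤ I.maxNodes)
    (fun _ _ h => h.1) fun _ _ _ => rfl).seq ((h₂.mono
      (pre' := fun I M => (Ready I M ∧ M.r = 0) ∧ M.tab = I.startTab ∧
        I.finalTab.cnt ≤ I.maxNodes) (fun _ _ h => h.1) fun _ _ _ => rfl).seq
      (h₃.seq ((h₄.mono (pre' := fun I M => M.m = I.m ∧ M.tab.cnt ≤ I.maxNodes) (fun _ _ h => h.1)
        fun _ _ _ => rfl).seq (h₅.seq h₆ fun _ _ _ => trivial) ?_) ?_) ?_) ?_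
  · obtain ⟨p, hp⟩ := key
    refine ⟨p, fun I hI => ?_⟩
    obtain ⟨T, hT, hr⟩ := hp I _ ⟨rfl, hI⟩
    rw [toStore_inputMem] at hr
    refine ⟨T, _, hr, hT, ?_⟩
    obtain ⟨g, gr, gt⟩ := h₁' I
    set M₁ := f₁ I (inputMem I)
    obtain ⟨hM, ht⟩ := h₂' I M₁ ⟨g, gr⟩
    set M₂ := (roundMem k)^[M₁.n] M₁
    rw [gt] at ht
    change M₂.tab = I.finalTab at ht
    have hxt : M₂.xt = I.diag I.t := hM.xt
    set M₃ : Mem := { M₂ with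
      id := M₂.tab.F M₂.xt, j := M₂.m
      a1 := fun a => if a < M₂.m then if 0 ≤ M₂.c a then 0 else 1 else M₂.a1 a } with hM₃
    obtain ⟨e1, e2, e3⟩ := h₅' I M₃ (by rw [hM₃]; simpa only [ht] using hI)
    change (f₅ I M₃).tab = M₂.tab at e1
    change (f₅ I M₃).xt = M₂.xt at e2
    refine ⟨?_, fun G hG hlt a => ?_⟩
    · change (if (f₅ I M₃).tab.F (f₅ I M₃).xt = 0 then 0 else 1) = _
      rw [e1, e2, ht, hxt]
    · change (f₅ I M₃).a1 a = 1 ↔ _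
      rw [e3 G (by rw [← ht] at hG; exact hG) (by rw [hM₃]; simpa only [ht, hxt] using hlt)]
      have h1 : M₃.id = I.finalTab.F (I.diag I.t) := by rw [hM₃]; simp only [ht, hxt]
      have h2 : M₃.a1 a = if 0 ≤ I.cost a then 0 else 1 := by
        rw [hM₃]; simp only [hM.m, a.2, if_true, hM.c a]
      rw [h1, h2]
      by_cases hc : 0 ≤ I.cost a <;> simp [hc, not_lt.mpr, not_le.mp]
  · exact fun I M hM => hM.2
  · exact fun I M hM => ⟨hM.1.m, by simpa only [hM.2.1] using hM.2.2⟩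
  · exact fun I M hM => ⟨(h₂' I M hM.1).1, (h₂' I M hM.1).2.trans (by rw [hM.2.1]; rfl), hM.2.2⟩
  · rintro I _ ⟨rfl, hI⟩
    exact ⟨⟨(h₁' I).1, (h₁' I).2.1⟩, (h₁' I).2.2, hI⟩

end Program

/-! ### Acyclic digraphs -/

namespace ArcDigraph

variable {D : ArcDigraph}

theorem IsWalk.append {l₁ l₂ : List (Fin D.m)} {u v w : Fin D.n} (h₁ : D.IsWalk l₁ u v)
    (h₂ : D.IsWalk l₂ v w) : D.IsWalk (l₁ ++ l₂) u w := by
  induction l₁ generalizing u with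
  | nil => obtain rfl : u = v := h₁; exact h₂
  | cons a l ih => exact ⟨h₁.1, ih h₁.2⟩

theorem IsWalk.of_append {l₁ l₂ : List (Fin D.m)} {u w : Fin D.n}
    (h : D.IsWalk (l₁ ++ l₂) u w) : ∃ v, D.IsWalk l₁ u v ∧ D.IsWalk l₂ v w := by
  induction l₁ generalizing u with
  | nil => exact ⟨u, rfl, h⟩
  | cons a l ih =>
    obtain ⟨v, h₁, h₂⟩ := ih h.2
    exact ⟨v, ⟨h.1, h₁⟩, h₂⟩

theorem IsWalk.head_eq {l : List (Fin D.m)} {a : Fin D.m} {u v : Fin D.n}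
    (h : D.IsWalk (l ++ [a]) u v) : D.head a = v := by
  obtain ⟨w, -, h₂⟩ := h.of_append
  exact h₂.2

/-- A closed walk of minimal length is a directed cycle. -/
theorem IsAcyclic.eq_nil (hD : D.IsAcyclic) {l : List (Fin D.m)} {v : Fin D.n}
    (h : D.IsWalk l v v) : l = [] := by
  induction hn : l.length using Nat.strong_induction_on generalizing l v with
  | _ n ih =>
    subst hn
    by_contra hl
    refine hD v l ⟨hl, h, ?_⟩
    rw [List.nodup_iff_getElem?_ne_getElem?]
    intro i j hij hj he
    rw [List.length_map] at hj
    -- if the heads of the arcs `i < j` agree, then the arcs `i + 1, …, j` form a closed walk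
    have hl' : l = l.take (i + 1) ++ ((l.take (j + 1)).drop (i + 1) ++ l.drop (j + 1)) := by
      rw [← List.append_assoc]
      conv_lhs => rw [← List.take_append_drop (j + 1) l]
      congr 1
      conv_lhs => rw [← List.take_append_drop (i + 1) (l.take (j + 1)), List.take_take,
        min_eq_left (by omega)]
    rw [hl'] at h
    obtain ⟨u, h₁, h₂⟩ := h.of_append
    obtain ⟨w, h₂, -⟩ := h₂.of_append
    have hu : D.head l[i] = u := by
      rw [List.take_succ_eq_append_getElem (by omega)] at h₁
      exact h₁.head_eq
    have hw : D.head l[j] = w := by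
      rw [List.take_succ_eq_append_getElem hj, List.drop_append_of_le_length
        (by rw [List.length_take]; omega)] at h₂
      exact h₂.head_eq
    have huw : u = w := by
      rw [← hu, ← hw]
      simpa [List.getElem?_eq_getElem hj, List.getElem?_eq_getElem (hij.trans hj)] using he
    subst huw
    have := ih _ (by simp only [List.length_drop, List.length_take]; omega) h₂ rfl
    rw [List.drop_eq_nil_iff, List.length_take] at this
    omega

/-- An acyclic digraph has a rank function that increases along the arcs: the number of
predecessors of a vertex. -/
theorem IsAcyclic.exists_rank (hD : D.IsAcyclic) :
    ∃ h : Fin D.n → ℕ, (∀ v, h v < D.n) ∧ ∀ a, h (D.tail a) < h (D.head a) := by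
  classical
  let R (u v : Fin D.n) : Prop := ∃ l, l ≠ [] ∧ D.IsWalk l u v
  have hR : ∀ v, ¬ R v v := fun v ⟨l, hl, h⟩ => hl (hD.eq_nil h)
  refine ⟨fun v => (Finset.univ.filter fun u => R u v).card, fun v => ?_, fun a => ?_⟩
  · have := Finset.card_lt_card (Finset.filter_ssubset (p := fun u => R u v).mpr
      ⟨v, Finset.mem_univ _, hR v⟩)
    rwa [Finset.card_univ, Fintype.card_fin] at this
  · refine Finset.card_lt_card (Finset.ssubset_iff_of_subset ?_ |>.mpr ⟨D.tail a, ?_, ?_⟩)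
    · intro u hu
      simp only [Finset.mem_filter, Finset.mem_univ, true_and] at hu ⊢
      obtain ⟨l, hl, h⟩ := hu
      exact ⟨l ++ [a], by simp, h.append ⟨rfl, rfl⟩⟩
    · simpa using ⟨[a], by simp, rfl, rfl⟩
    · simpa using hR _

theorem IsWalk.rank_le {h : Fin D.n → ℕ} (hh : ∀ a, h (D.tail a) < h (D.head a))
    {l : List (Fin D.m)} {u v : Fin D.n} (hl : D.IsWalk l u v) {a : Fin D.m} (ha : a ∈ l) :
    h u ≤ h (D.tail a) := by
  induction l generalizing u with
  | nil => simp at ha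
  | cons b l ih =>
    rcases List.mem_cons.mp ha with rfl | ha
    · rw [hl.1]
    · rw [← hl.1]; exact (hh b).le.trans (ih hl.2 ha)

theorem IsWalk.isDipath {h : Fin D.n → ℕ} (hh : ∀ a, h (D.tail a) < h (D.head a))
    {l : List (Fin D.m)} {u v : Fin D.n} (hl : D.IsWalk l u v) : D.IsDipath l u v := by
  refine ⟨hl, ?_⟩
  induction l generalizing u with
  | nil => simp
  | cons a l ih =>
    refine List.nodup_cons.mpr ⟨fun hu => ?_, ih hl.2⟩
    obtain ⟨b, hb, hbu⟩ := List.mem_map.mp hu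
    have := hl.rank_le hh hb
    have := hh b
    rw [hbu] at this
    omega

end ArcDigraph

/-! ### States as numbers -/

namespace SimInstance

variable {k : ℕ} (I : SimInstance k)

/-- The number of the state in which the token of color `i` is at `v i`. -/
def enc (v : Fin k → Fin I.n) : ℕ := ∑ i : Fin k, (v i : ℕ) * I.n ^ (i : ℕ)

theorem enc_lt (v : Fin k → Fin I.n) : I.enc v < I.n ^ k := (finFunctionFinEquiv v).2

theorem exists_enc {x : ℕ} (hx : x < I.n ^ k) : ∃ v, I.enc v = x :=
  ⟨finFunctionFinEquiv.symm ⟨x, hx⟩,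
    congrArg Fin.val (finFunctionFinEquiv.apply_symm_apply ⟨x, hx⟩)⟩

theorem enc_digit (v : Fin k → Fin I.n) (i : Fin k) :
    I.enc v / I.n ^ (i : ℕ) % I.n = v i :=
  congrArg Fin.val (congrFun (finFunctionFinEquiv.symm_apply_apply v) i)

theorem enc_injective : Function.Injective I.enc := fun v w h => by
  funext i
  rw [Fin.ext_iff, ← I.enc_digit, h, I.enc_digit]

theorem enc_update (v : Fin k → Fin I.n) (i : Fin k) (u : Fin I.n) :
    I.enc v + u * I.n ^ (i : ℕ) - v i * I.n ^ (i : ℕ) = I.enc (Function.update v i u) := by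
  have h₁ := Finset.add_sum_erase Finset.univ (fun j => (v j : ℕ) * I.n ^ (j : ℕ))
    (Finset.mem_univ i)
  have h₂ := Finset.add_sum_erase Finset.univ
    (fun j => (Function.update v i u j : ℕ) * I.n ^ (j : ℕ)) (Finset.mem_univ i)
  have h₃ : ∑ j ∈ Finset.univ.erase i, (Function.update v i u j : ℕ) * I.n ^ (j : ℕ) =
      ∑ j ∈ Finset.univ.erase i, (v j : ℕ) * I.n ^ (j : ℕ) :=
    Finset.sum_congr rfl fun j hj => by rw [Function.update_of_ne (Finset.ne_of_mem_erase hj)]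
  rw [h₃] at h₂
  simp only [Function.update_self] at h₂
  unfold enc
  omega

theorem diag_eq_enc (u : Fin I.n) : I.diag u = I.enc fun _ => u := Finset.sum_range _

theorem price_nonneg (a : Fin I.m) : 0 ≤ I.price a := le_max_right _ _

end SimInstance

/-! ### Sweeps -/

namespace Tab

theorem sweep_induction {f : Tab → ℕ → Tab} {Q : ℕ → Tab → Prop} {N : ℕ} {T : Tab} (h0 : Q 0 T)
    (h : ∀ i < N, ∀ T, Q i T → Q (i + 1) (f T i)) : Q N (sweep f N T) := by
  induction N with
  | zero => exact h0
  | succ N ih => exact h N (by omega) _ (ih fun i hi => h i (by omega))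

theorem sweep_preserves {f : Tab → ℕ → Tab} {Q : Tab → Prop} {N : ℕ} {T : Tab} (h0 : Q T)
    (h : ∀ i < N, ∀ T, Q T → Q (f T i)) : Q (sweep f N T) :=
  sweep_induction (Q := fun _ => Q) h0 h

/-- If the operation `f · x` achieves `Q'`, and the others preserve it, then the sweep does. -/
theorem sweep_achieves {f : Tab → ℕ → Tab} {Q Q' : Tab → Prop} {N x : ℕ} {T : Tab} (h0 : Q T)
    (hx : x < N) (hQ : ∀ i T, Q T → Q (f T i)) (hQ' : ∀ i T, Q' T → Q' (f T i))
    (h : ∀ T, Q T → Q' (f T x)) : Q' (sweep f N T) := by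
  refine (sweep_induction (Q := fun i T => Q T ∧ (x < i → Q' T)) ⟨h0, by simp⟩
    fun i hi T hT => ⟨hQ i T hT.1, fun hxi => ?_⟩).2 hx
  rcases (Nat.lt_succ_iff.mp hxi).eq_or_lt with rfl | hlt
  exacts [h T hT.1, hQ' i T (hT.2 hlt)]

theorem sweep_cnt_le {f : Tab → ℕ → Tab} {d N : ℕ} (h : ∀ T i, (f T i).cnt ≤ T.cnt + d) (T : Tab) :
    (sweep f N T).cnt ≤ T.cnt + N * d := by
  induction N with
  | zero => simp [sweep]
  | succ N ih => rw [sweep, Nat.succ_mul]; have := h (sweep f N T) N; omega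

theorem relax_eq_or (T : Tab) (y x : ℕ) : T.relax y x = T ∨
    T.F x ≠ 0 ∧ (T.F y ≠ 0 → T.cost (T.F x) ≤ T.cost (T.F y)) ∧
      T.relax y x = { T with F := Function.update T.F y (T.F x) } := by
  unfold relax
  split_ifs with h
  · refine .inr ⟨h.1, fun hy => ?_, rfl⟩
    by_contra hc
    exact h.2 ⟨hy, (not_le.mp hc).le⟩
  · exact .inl rfl

@[simp] theorem relax_cnt (T : Tab) (y x : ℕ) : (T.relax y x).cnt = T.cnt := by
  unfold relax; split_ifs <;> rfl

theorem move_cnt (p : Prop) (N n w u v : ℕ) (T : Tab) (x : ℕ) :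
    (T.move p N n w u v x).cnt = T.cnt := by
  unfold move; split_ifs <;> simp

/-! ### Upper bounds for the entries of the table -/

/-- The cell `x` is not empty, and the price of its entry is at most `b`. -/
def Cheap (T : Tab) (x : ℕ) (b : ℝ) : Prop := T.F x ≠ 0 ∧ T.cost (T.F x) ≤ b

theorem Cheap.relax {T : Tab} {z : ℕ} {b : ℝ} (h : T.Cheap z b) (y x : ℕ) :
    (T.relax y x).Cheap z b := by
  rcases T.relax_eq_or y x with e | ⟨h₁, h₂, e⟩
  · rwa [e]
  · rw [e]
    by_cases hz : z = y
    · subst hz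
      simpa [Cheap, h₁] using (h₂ h.1).trans h.2
    · simpa [Cheap, Function.update_of_ne hz] using h

theorem Cheap.relax_self {T : Tab} {x : ℕ} {b : ℝ} (h : T.Cheap x b) (y : ℕ) :
    (T.relax y x).Cheap y b := by
  unfold Tab.relax
  split_ifs with hc
  · simpa [Cheap] using h
  · have : T.F y ≠ 0 ∧ T.cost (T.F y) ≤ T.cost (T.F x) := by
      by_contra h'
      exact hc ⟨h.1, h'⟩
    exact ⟨this.1, this.2.trans h.2⟩

theorem Cheap.move {T : Tab} {z : ℕ} {b : ℝ} (h : T.Cheap z b) (p : Prop) (N n w u v x : ℕ) :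
    (T.move p N n w u v x).Cheap z b := by
  unfold Tab.move
  split_ifs
  exacts [h.relax _ _, h]

theorem Cheap.alloc {T : Tab} (hT : ∀ x, T.F x < T.cnt) {z : ℕ} {b : ℝ} (h : T.Cheap z b)
    {y : ℕ} (hy : z ≠ y) (a : ℕ) (p : ℝ) (x : ℕ) : (T.alloc a p y x).Cheap z b := by
  simpa [Cheap, Tab.alloc, Function.update_of_ne hy, Function.update_of_ne (hT z).ne] using h

theorem Cheap.alloc_self {T : Tab} (hT : ∀ x, T.F x < T.cnt) {x : ℕ} {b : ℝ} (h : T.Cheap x b)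
    (a : ℕ) (p : ℝ) (y : ℕ) : (T.alloc a p y x).Cheap y (b + p) := by
  have : T.cnt ≠ 0 := (Nat.zero_le _).trans_lt (hT x) |>.ne'
  simpa [Cheap, Tab.alloc, h.1, this] using h.2

theorem alloc_F_lt {T : Tab} (hT : ∀ x, T.F x < T.cnt) (a : ℕ) (p : ℝ) (y x z : ℕ) :
    (T.alloc a p y x).F z < (T.alloc a p y x).cnt := by
  simp only [alloc, Function.update_apply]
  have := hT z
  split_ifs <;> omega

end Tab

namespace SimInstance

variable {k : ℕ} (I : SimInstance k)

theorem cheap_openTab {T : Tab} (hT : ∀ x, T.F x < T.cnt) (a : Fin I.m) {x : ℕ} (hx : x < I.n ^ k)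
    {b : ℝ} (h : T.Cheap x b) :
    (I.openTab a T).Cheap x b ∧ (I.openTab a T).Cheap (I.n ^ k + x) (b + I.price a) := by
  have step : ∀ (i : ℕ) (T : Tab), ((∀ x, T.F x < T.cnt) ∧ T.Cheap x b) →
      (∀ x, (T.alloc a (I.price a) (I.n ^ k + i) i).F x <
        (T.alloc a (I.price a) (I.n ^ k + i) i).cnt) ∧
      (T.alloc a (I.price a) (I.n ^ k + i) i).Cheap x b := fun i T hT =>
    ⟨T.alloc_F_lt hT.1 _ _ _ _, hT.2.alloc hT.1 (by omega) _ _ _⟩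
  refine ⟨(Tab.sweep_preserves (Q := fun T => (∀ x, T.F x < T.cnt) ∧ T.Cheap x b) ⟨hT, h⟩
    fun i _ => step i).2, ?_⟩
  refine (Tab.sweep_induction (Q := fun i T => ((∀ x, T.F x < T.cnt) ∧ T.Cheap x b) ∧
    (x < i → T.Cheap (I.n ^ k + x) (b + I.price a))) ⟨⟨hT, h⟩, by simp⟩
    fun i _ T hT => ⟨step i T hT.1, fun hxi => ?_⟩).2 hx
  rcases (Nat.lt_succ_iff.mp hxi).eq_or_lt with rfl | hlt
  · exact hT.1.2.alloc_self hT.1.1 _ _ _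
  · exact (hT.2 hlt).alloc hT.1.1 (by omega) _ _ _

theorem cheap_closeTab {T : Tab} {x : ℕ} (hx : x < I.n ^ k) {b : ℝ}
    (h : T.Cheap x b ∨ T.Cheap (I.n ^ k + x) b) : (I.closeTab T).Cheap x b := by
  rcases h with h | h
  · exact Tab.sweep_preserves (Q := fun T => T.Cheap x b) h fun i _ T hT => hT.relax _ _
  · exact Tab.sweep_achieves (Q := fun T => T.Cheap (I.n ^ k + x) b) (Q' := fun T => T.Cheap x b) h
      hx (fun i T hT => hT.relax _ _) (fun i T hT => hT.relax _ _) fun T hT => hT.relax_self _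

theorem cheap_moveTab {T : Tab} {z : ℕ} {b : ℝ} (h : T.Cheap z b) (a : Fin I.m) (i : ℕ) :
    (I.moveTab a T i).Cheap z b :=
  Tab.sweep_preserves (Q := fun T => T.Cheap z b) h fun _ _ _ hT => hT.move _ _ _ _ _ _ _

theorem cheap_moveTab_update {T : Tab} {v : Fin k → Fin I.n} {b : ℝ}
    (h : T.Cheap (I.n ^ k + I.enc v) b) {a : Fin I.m} {i : Fin k} (ha : a ∈ I.color i)
    (hv : v i = I.tail a) :
    (I.moveTab a T i).Cheap (I.n ^ k + I.enc (Function.update v i (I.head a))) b := by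
  refine Tab.sweep_achieves (Q := fun T => T.Cheap (I.n ^ k + I.enc v) b)
    (Q' := fun T => T.Cheap (I.n ^ k + I.enc (Function.update v i (I.head a))) b) (x := I.enc v) h
    (I.enc_lt v) (fun _ _ hT => hT.move _ _ _ _ _ _ _)
    (fun _ _ hT => hT.move _ _ _ _ _ _ _) fun T hT => ?_
  rw [Tab.move, if_pos ⟨⟨i.2, ha⟩, by rw [I.enc_digit, hv]⟩, ← hv, I.enc_update]
  exact hT.relax_self _

theorem cheap_arcTab {T : Tab} (hT : ∀ x, T.F x < T.cnt) (a : Fin I.m) {v : Fin k → Fin I.n}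
    {b : ℝ} (h : T.Cheap (I.enc v) b) : (I.arcTab a T).Cheap (I.enc v) b :=
  I.cheap_closeTab (I.enc_lt v) <| .inl <|
    Tab.sweep_preserves (Q := fun T => T.Cheap _ b) (I.cheap_openTab hT a (I.enc_lt v) h).1
      fun i _ _ hT => I.cheap_moveTab hT a i

theorem cheap_arcTab_move {T : Tab} (hT : ∀ x, T.F x < T.cnt) (a : Fin I.m) {v : Fin k → Fin I.n}
    {b : ℝ} (h : T.Cheap (I.enc v) b) (S : Fin k → Prop) [DecidablePred S]
    (hS : ∀ i, S i → a ∈ I.color i ∧ v i = I.tail a) :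
    (I.arcTab a T).Cheap (I.enc fun i => if S i then I.head a else v i) (b + I.price a) := by
  refine I.cheap_closeTab (I.enc_lt _) (.inr ?_)
  have := Tab.sweep_induction (f := I.moveTab a) (N := k) (T := I.openTab a T)
    (Q := fun j T => T.Cheap
      (I.n ^ k + I.enc fun i => if S i ∧ (i : ℕ) < j then I.head a else v i) (b + I.price a))
    (by simpa using (I.cheap_openTab hT a (I.enc_lt v) h).2)
    (fun j hj T hT => by
      by_cases hSj : S ⟨j, hj⟩
      · have := I.cheap_moveTab_update hT (i := ⟨j, hj⟩) (hS _ hSj).1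
          (by simpa using (hS _ hSj).2)
        convert this using 4 with i
        by_cases hij : i = ⟨j, hj⟩
        · subst hij; simp [hSj]
        · have : (i : ℕ) ≠ j := fun e => hij (Fin.ext e)
          simp only [Function.update_of_ne hij, show ((i : ℕ) < j + 1 ↔ (i : ℕ) < j) by omega]
      · convert I.cheap_moveTab hT a j using 4 with i
        by_cases hij : i = ⟨j, hj⟩
        · subst hij; simp [hSj]
        · have : (i : ℕ) ≠ j := fun e => hij (Fin.ext e)
          simp only [show ((i : ℕ) < j + 1 ↔ (i : ℕ) < j) by omega])
  simpa using this

/-! ### The entries of the table are feasible -/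

/-- For every color `i`, the set `S` contains a walk of color `i` from `s` to `v i`. -/
def Reach (S : Finset (Fin I.m)) (v : Fin k → Fin I.n) : Prop :=
  ∀ i, ∃ l, I.toArcDigraph.IsWalk l I.s (v i) ∧ ∀ a ∈ l, a ∈ S ∧ a ∈ I.color i

variable {I}

theorem Reach.mono {S S' : Finset (Fin I.m)} {v : Fin k → Fin I.n} (h : I.Reach S v)
    (hS : S ⊆ S') : I.Reach S' v := fun i => by
  obtain ⟨l, hl, h'⟩ := h i
  exact ⟨l, hl, fun a ha => ⟨hS (h' a ha).1, (h' a ha).2⟩⟩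

theorem Reach.update {S : Finset (Fin I.m)} {v : Fin k → Fin I.n} (h : I.Reach S v) {a : Fin I.m}
    (ha : a ∈ S) {i : Fin k} (hi : a ∈ I.color i) (hv : v i = I.tail a) :
    I.Reach S (Function.update v i (I.head a)) := fun j => by
  by_cases hj : j = i
  · subst hj
    obtain ⟨l, hl, h'⟩ := h j
    refine ⟨l ++ [a], ?_, ?_⟩
    · rw [Function.update_self]
      exact hl.append ⟨hv.symm, rfl⟩
    · intro b hb
      rcases List.mem_append.mp hb with hb | hb
      · exact h' b hb
      · obtain rfl := List.mem_singleton.mp hb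
        exact ⟨ha, hi⟩
  · rw [Function.update_of_ne hj]
    exact h j

variable (I)

/-- The nodes of the table represent the arc sets `G i`, at prices that are large enough, and the
entries of the states are arc sets in which the tokens can reach their positions. -/
structure Sound (T : Tab) (G : ℕ → Finset (Fin I.m)) : Prop where
  chain : T.Chain G
  two_le : 2 ≤ T.cnt
  lt : ∀ x, T.F x < T.cnt
  cost : ∀ i < T.cnt, ∑ a ∈ G i, I.price a ≤ T.cost i
  reach : ∀ v, T.F (I.enc v) ≠ 0 → I.Reach (G (T.F (I.enc v))) v

/-- A sound table with a transaction for the arc `a`, opened for the states below `i`: their entries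
in the upper half of the table contain this arc. -/
structure SoundOpen (T : Tab) (G : ℕ → Finset (Fin I.m)) (a : Fin I.m) (i : ℕ) : Prop
    extends I.Sound T G where
  upper : ∀ v, I.enc v < i → T.F (I.n ^ k + I.enc v) ≠ 0 →
    a ∈ G (T.F (I.n ^ k + I.enc v)) ∧ I.Reach (G (T.F (I.n ^ k + I.enc v))) v

variable {I}

theorem SoundOpen.relax {T : Tab} {G : ℕ → Finset (Fin I.m)} {a : Fin I.m} {i : ℕ}
    (h : I.SoundOpen T G a i) {y x : ℕ}
    (hl : T.F x ≠ 0 → ∀ v, I.enc v = y → I.Reach (G (T.F x)) v)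
    (hu : T.F x ≠ 0 → ∀ v, I.n ^ k + I.enc v = y → a ∈ G (T.F x) ∧ I.Reach (G (T.F x)) v) :
    I.SoundOpen (T.relax y x) G a i := by
  rcases T.relax_eq_or y x with e | ⟨h₁, -, e⟩
  · rwa [e]
  rw [e]
  refine ⟨⟨⟨h.chain.empty, h.chain.prev_lt, h.chain.insert⟩, h.two_le, fun z => ?_, h.cost,
    fun v hv => ?_⟩, fun v hi hv => ?_⟩
  · simp only [Function.update_apply]
    split_ifs
    exacts [h.lt x, h.lt z]
  · simp only [Function.update_apply] at hv ⊢
    split_ifs at hv ⊢ with hy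
    exacts [hl h₁ v hy, h.reach v hv]
  · simp only [Function.update_apply] at hv ⊢
    split_ifs at hv ⊢ with hy
    exacts [hu h₁ v hy, h.upper v hi hv]

theorem SoundOpen.alloc {T : Tab} {G : ℕ → Finset (Fin I.m)} {a : Fin I.m} {x : ℕ}
    (h : I.SoundOpen T G a x) (hx : x < I.n ^ k) :
    I.SoundOpen (T.alloc a (I.price a) (I.n ^ k + x) x)
      (Function.update G T.cnt (insert a (G (T.F x)))) a (x + 1) := by
  have hG : ∀ i < T.cnt, Function.update G T.cnt (insert a (G (T.F x))) i = G i :=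
    fun i hi => Function.update_of_ne hi.ne _ _
  have h2 := h.two_le
  refine ⟨⟨⟨fun i hi => ?_, fun i h₁ hi => ?_, fun i h₁ hi => ?_⟩, ?_,
    T.alloc_F_lt h.lt _ _ _ _, fun i hi => ?_, fun v hv => ?_⟩, fun v hi hv => ?_⟩
  · rw [hG i (by omega), h.chain.empty i hi]
  · simp only [Tab.alloc, Function.update_apply] at hi ⊢
    split_ifs with hc
    · rw [hc]; exact h.lt x
    · exact h.chain.prev_lt i h₁ (by omega)
  · simp only [Tab.alloc] at hi ⊢
    rcases (Nat.lt_succ_iff.mp hi).eq_or_lt with rfl | hlt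
    · refine ⟨a, by simp, ?_⟩
      simp only [Function.update_self]
      rw [hG _ (h.lt x)]
    · obtain ⟨b, hb, hb'⟩ := h.chain.insert i h₁ hlt
      refine ⟨b, by simp [Function.update_of_ne hlt.ne, hb], ?_⟩
      rw [hG i hlt, Function.update_of_ne hlt.ne, hG _ ((h.chain.prev_lt i h₁ hlt).trans hlt), hb']
  · simp only [Tab.alloc]; omega
  · simp only [Tab.alloc] at hi ⊢
    rcases (Nat.lt_succ_iff.mp hi).eq_or_lt with rfl | hlt
    · simp only [Function.update_self]
      have h₁ := h.cost _ (h.lt x)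
      have h₂ := I.price_nonneg a
      by_cases ha : a ∈ G (T.F x)
      · rw [Finset.insert_eq_of_mem ha]; linarith
      · rw [Finset.sum_insert ha]; linarith
    · rw [hG i hlt, Function.update_of_ne hlt.ne]
      exact h.cost i hlt
  · have hne : I.enc v ≠ I.n ^ k + x := by have := I.enc_lt v; omega
    simp only [Tab.alloc, Function.update_of_ne hne] at hv ⊢
    rw [hG _ (h.lt _)]
    exact h.reach v hv
  · simp only [Tab.alloc] at hv ⊢
    rcases (Nat.lt_succ_iff.mp hi).eq_or_lt with rfl | hlt
    · have hF : T.F (I.enc v) ≠ 0 := fun e => by simp [e] at hv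
      simp only [Function.update_self, if_neg hF]
      exact ⟨Finset.mem_insert_self _ _, (h.reach v hF).mono (Finset.subset_insert _ _)⟩
    · have hne : I.n ^ k + I.enc v ≠ I.n ^ k + x := by omega
      rw [Function.update_of_ne hne] at hv ⊢
      rw [hG _ (h.lt _)]
      exact h.upper v hlt hv

theorem Sound.arcTab {T : Tab} (hT : ∃ G, I.Sound T G) (a : Fin I.m) :
    ∃ G, I.Sound (I.arcTab a T) G := by
  obtain ⟨G, hG⟩ := hT
  have h₁ : ∃ G, I.SoundOpen (I.openTab a T) G a (I.n ^ k) :=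
    Tab.sweep_induction (Q := fun i T => ∃ G, I.SoundOpen T G a i)
      ⟨G, hG, fun v hv => absurd hv (Nat.not_lt_zero _)⟩
      fun i hi T ⟨G, hG⟩ => ⟨_, hG.alloc hi⟩
  obtain ⟨G, hG⟩ := h₁
  have h₂ : I.SoundOpen (Tab.sweep (I.moveTab a) k (I.openTab a T)) G a (I.n ^ k) := by
    refine Tab.sweep_preserves (Q := fun T => I.SoundOpen T G a (I.n ^ k)) hG fun i hi T hT => ?_
    refine Tab.sweep_preserves (Q := fun T => I.SoundOpen T G a (I.n ^ k)) hT fun x hx T hT => ?_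
    unfold Tab.move
    split_ifs with hc
    · obtain ⟨⟨hi, ha⟩, hx'⟩ := hc
      obtain ⟨v, rfl⟩ := I.exists_enc hx
      have hv := I.enc_digit v ⟨i, hi⟩
      simp only [hx'] at hv
      have he := I.enc_update v ⟨i, hi⟩ (I.head a)
      simp only [← hv] at he
      rw [he]
      refine hT.relax (fun _ w hw => ?_) fun hF w hw => ?_
      · have := I.enc_lt w; omega
      · obtain rfl := I.enc_injective (Nat.add_left_cancel hw)
        obtain ⟨ha', hr⟩ := hT.upper v hx hF
        exact ⟨ha', hr.update ha' ha (Fin.ext hv.symm)⟩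
    · exact hT
  refine ⟨G, (Tab.sweep_preserves (Q := fun T => I.SoundOpen T G a (I.n ^ k)) h₂
    fun x hx T hT => hT.relax (fun hF w hw => ?_) fun _ w hw => ?_).toSound⟩
  · subst hw
    exact (hT.upper w hx hF).2
  · omega

theorem Sound.roundTab {T : Tab} (hT : ∃ G, I.Sound T G) : ∃ G, I.Sound (I.roundTab T) G :=
  Tab.sweep_preserves (Q := fun T => ∃ G, I.Sound T G) hT fun i hi T hT => by
    rw [dif_pos hi]; exact Sound.arcTab hT _

variable (I)

theorem sound_startTab : ∃ G, I.Sound I.startTab G := by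
  refine ⟨fun _ => ∅, ⟨fun _ _ => rfl, fun i h₁ h₂ => ?_, fun i h₁ h₂ => ?_⟩, le_rfl, fun x => ?_,
    fun i _ => by simp [startTab], fun v hv i => ⟨[], ?_, by simp⟩⟩
  · simp only [startTab] at h₂; omega
  · simp only [startTab] at h₂; omega
  · simp only [startTab, Function.update_apply]
    split_ifs <;> omega
  · simp only [startTab, Function.update_apply, diag_eq_enc] at hv
    have : v = fun _ => I.s := I.enc_injective (by by_contra h; exact hv (if_neg h))
    rw [this]
    rfl

theorem sound_finalTab : ∃ G, I.Sound I.finalTab G :=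
  Tab.sweep_preserves (Q := fun T => ∃ G, I.Sound T G) I.sound_startTab
    fun _ _ _ hT => Sound.roundTab hT

theorem arcTab_cnt_le (a : Fin I.m) (T : Tab) : (I.arcTab a T).cnt ≤ T.cnt + I.n ^ k := by
  have h₁ : (I.openTab a T).cnt ≤ T.cnt + I.n ^ k * 1 := Tab.sweep_cnt_le (fun _ _ => le_rfl) T
  have h₂ : ∀ T : Tab, (Tab.sweep (I.moveTab a) k T).cnt ≤ T.cnt + k * (I.n ^ k * 0) :=
    Tab.sweep_cnt_le fun T i => Tab.sweep_cnt_le (fun T x => (T.move_cnt _ _ _ _ _ _ x).le) T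
  have h₃ : ∀ T, (I.closeTab T).cnt ≤ T.cnt + I.n ^ k * 0 :=
    Tab.sweep_cnt_le fun T x => (T.relax_cnt _ _).le
  have := h₃ (Tab.sweep (I.moveTab a) k (I.openTab a T))
  have := h₂ (I.openTab a T)
  simp only [Nat.mul_zero, Nat.mul_one] at *
  unfold arcTab
  omega

theorem finalTab_cnt_le : I.finalTab.cnt ≤ I.maxNodes :=
  Tab.sweep_cnt_le (fun T _ => Tab.sweep_cnt_le (fun T j => by
    split_ifs
    exacts [I.arcTab_cnt_le _ T, Nat.le_add_right _ _]) T) _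

/-! ### The table is optimal -/

/-- The arc `a` has its turn, in the round given by the rank of its tail, not before the step for
the arc `j` of the round `r`. -/
def Later (h : Fin I.n → ℕ) (r j : ℕ) (a : Fin I.m) : Prop :=
  r < h (I.tail a) ∨ (h (I.tail a) = r ∧ j ≤ a)

open Classical in
/-- The table has an entry that can be completed to a feasible solution within `B` by arcs that are
still to come, and whose price is at most that of the other arcs of `B`. -/
def Completable (h : Fin I.n → ℕ) (B : Finset (Fin I.m)) (r j : ℕ) (T : Tab) : Prop :=
  ∃ (v : Fin k → Fin I.n) (l : Fin k → List (Fin I.m)),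
    (∀ i, I.toArcDigraph.IsWalk (l i) (v i) I.t ∧
      ∀ a ∈ l i, a ∈ B ∧ a ∈ I.color i ∧ I.Later h r j a) ∧
    T.Cheap (I.enc v) (∑ a ∈ B with ¬ I.Later h r j a, I.price a)

variable {I}

theorem Completable.arcTab {h : Fin I.n → ℕ} (hh : ∀ a, h (I.tail a) < h (I.head a))
    {B : Finset (Fin I.m)} {r : ℕ} {j : Fin I.m} {T : Tab} (hT : ∀ x, T.F x < T.cnt)
    (hc : I.Completable h B r j T) : I.Completable h B r (j + 1) (I.arcTab j T) := by
  classical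
  obtain ⟨v, l, hl, hC⟩ := hc
  have later_succ : ∀ a, I.Later h r j a → a ≠ j ∨ h (I.tail a) ≠ r → I.Later h r (j + 1) a := by
    rintro a (ha | ⟨ha, ha'⟩) hne
    · exact .inl ha
    · have : (a : ℕ) ≠ j := fun e => hne.elim (fun h => h (Fin.ext e)) fun h => h ha
      exact .inr ⟨ha, by omega⟩
  have later_of_succ : ∀ a, I.Later h r (j + 1) a → I.Later h r j a := by
    rintro a (ha | ⟨ha, ha'⟩)
    exacts [.inl ha, .inr ⟨ha, by omega⟩]
  by_cases hS : ∃ i, j ∈ l i ∧ h (I.tail j) = r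
  · obtain ⟨i₀, hi₀, hr⟩ := hS
    -- an arc whose turn it is can only be the first one of the rest of a walk
    have hfirst : ∀ i, j ∈ l i → ∃ l', l i = j :: l' := by
      intro i hi
      obtain ⟨hw, ha⟩ := hl i
      cases hli : l i with
      | nil => simp [hli] at hi
      | cons b l' =>
        rw [hli] at hw ha hi
        rcases List.mem_cons.mp hi with rfl | hi
        · exact ⟨l', rfl⟩
        · have h₁ := hw.2.rank_le hh hi
          have h₂ := hh b
          have h₃ : r ≤ h (I.tail b) := by
            rcases (ha b (by simp)).2.2 with h | h
            exacts [h.le, h.1.ge]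
          change h (I.head b) ≤ h (I.tail j) at h₁
          omega
    refine ⟨fun i => if j ∈ l i then I.head j else v i, fun i => if j ∈ l i then (l i).tail else l i,
      fun i => ?_, ?_⟩
    · obtain ⟨hw, ha⟩ := hl i
      by_cases hi : j ∈ l i
      · simp only [if_pos hi]
        obtain ⟨l', hl'⟩ := hfirst i hi
        rw [hl'] at hw ha
        rw [hl', List.tail_cons]
        refine ⟨hw.2, fun a hal => ⟨(ha a (by simp [hal])).1, (ha a (by simp [hal])).2.1, .inl ?_⟩⟩
        have h₁ := hw.2.rank_le hh hal
        have h₂ := hh j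
        change h (I.head j) ≤ h (I.tail a) at h₁
        omega
      · simp only [if_neg hi]
        exact ⟨hw, fun a hal => ⟨(ha a hal).1, (ha a hal).2.1,
          later_succ a (ha a hal).2.2 (.inl fun e => hi (e ▸ hal))⟩⟩
    · have := I.cheap_arcTab_move hT j hC (fun i => j ∈ l i) fun i hi => by
        obtain ⟨hw, ha⟩ := hl i
        obtain ⟨l', hl'⟩ := hfirst i hi
        rw [hl'] at hw
        exact ⟨(ha j hi).2.1, hw.1.symm⟩
      refine ⟨this.1, this.2.trans ?_⟩
      have hj : j ∉ B.filter fun a => ¬ I.Later h r j a := by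
        simp only [Finset.mem_filter, not_and, not_not]
        exact fun _ => .inr ⟨hr, le_rfl⟩
      rw [add_comm, ← Finset.sum_insert hj]
      refine Finset.sum_le_sum_of_subset_of_nonneg ?_ fun a _ _ => I.price_nonneg a
      refine Finset.insert_subset ?_ fun a ha => ?_
      · refine Finset.mem_filter.mpr ⟨((hl i₀).2 j hi₀).1, ?_⟩
        rintro (h' | ⟨-, h'⟩) <;> omega
      · rw [Finset.mem_filter] at ha ⊢
        exact ⟨ha.1, fun h' => ha.2 (later_of_succ a h')⟩
  · refine ⟨v, l, fun i => ⟨(hl i).1, fun a ha => ⟨((hl i).2 a ha).1, ((hl i).2 a ha).2.1,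
      later_succ a ((hl i).2 a ha).2.2 ?_⟩⟩, ?_⟩
    · by_contra! hne
      obtain ⟨rfl, hr⟩ := hne
      exact hS ⟨i, ha, hr⟩
    · have := I.cheap_arcTab hT j hC
      refine ⟨this.1, this.2.trans ?_⟩
      refine Finset.sum_le_sum_of_subset_of_nonneg (fun a ha => ?_) fun a _ _ => I.price_nonneg a
      rw [Finset.mem_filter] at ha ⊢
      exact ⟨ha.1, fun h' => ha.2 (later_of_succ a h')⟩

theorem Completable.roundTab {h : Fin I.n → ℕ} (hh : ∀ a, h (I.tail a) < h (I.head a))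
    {B : Finset (Fin I.m)} {r : ℕ} {T : Tab} (hT : ∃ G, I.Sound T G)
    (hc : I.Completable h B r 0 T) : I.Completable h B (r + 1) 0 (I.roundTab T) := by
  have := (Tab.sweep_induction (f := fun T j => if h : j < I.m then I.arcTab ⟨j, h⟩ T else T)
    (N := I.m) (T := T) (Q := fun j T => (∃ G, I.Sound T G) ∧ I.Completable h B r j T) ⟨hT, hc⟩
    fun j hj T hT => by
      rw [dif_pos hj]
      obtain ⟨G, hG⟩ := hT.1
      exact ⟨Sound.arcTab hT.1 _, Completable.arcTab (j := ⟨j, hj⟩) hh hG.lt hT.2⟩).2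
  have e : I.Later h (r + 1) 0 = I.Later h r I.m := by
    funext a
    have := a.2
    simp only [Later, eq_iff_iff]
    omega
  unfold Completable at this ⊢
  rwa [e]

/-- A feasible solution `B` bounds the entry of the table for the state with all tokens at `t`. -/
theorem IsFeasible.cheap (hI : I.toArcDigraph.IsAcyclic) {B : Finset (Fin I.m)}
    (hB : I.IsFeasible B) : I.finalTab.Cheap (I.diag I.t) (∑ a ∈ B, I.price a) := by
  classical
  obtain ⟨h, hn, hh⟩ := hI.exists_rank
  choose l hl hlB using hB
  have h0 : I.Completable h B 0 0 I.startTab := by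
    have hlater : ∀ a, I.Later h 0 0 a := fun a => by simp only [Later]; omega
    refine ⟨fun _ => I.s, l, fun i => ⟨(hl i).1, fun a ha => ?_⟩, ?_⟩
    · have := Finset.mem_inter.mp (hlB i a ha)
      exact ⟨this.1, this.2, hlater a⟩
    · simp [Tab.Cheap, startTab, diag_eq_enc, hlater]
  obtain ⟨v, l', hl', hC⟩ := (Tab.sweep_induction (f := fun T _ => I.roundTab T) (N := I.n)
    (Q := fun r T => (∃ G, I.Sound T G) ∧ I.Completable h B r 0 T) ⟨I.sound_startTab, h0⟩
    fun r _ T hT => ⟨Sound.roundTab hT.1, hT.2.roundTab hh hT.1⟩).2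
  have hnot : ∀ a, ¬ I.Later h I.n 0 a := by
    intro a
    have : h (I.tail a) < I.n := hn _
    simp only [Later]
    omega
  have hv : v = fun _ => I.t := by
    funext i
    obtain ⟨hw, ha⟩ := hl' i
    cases hli : l' i with
    | nil => rw [hli] at hw; exact hw
    | cons a _ => exact absurd (ha a (by simp [hli])).2.2 (hnot a)
  rw [diag_eq_enc, ← hv]
  refine ⟨hC.1, hC.2.trans_eq ?_⟩
  simp [hnot]

end SimInstance

end SimPaths

theorem mainTheorem6 (k : ℕ) (hk : 1 ≤ k) :
    ∃ (P : SimPaths.Program) (p : Polynomial ℕ),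
      ∀ I : SimPaths.SimInstance k, I.toArcDigraph.IsAcyclic →
        ∃ (T : ℕ) (σ : SimPaths.Store),
          SimPaths.Runs P I.input T σ ∧ T ≤ p.eval (I.n + I.m) ∧ I.IsCorrectAnswer σ := by
  obtain ⟨p, hp⟩ := SimPaths.Program.main_spec k
  refine ⟨SimPaths.Program.main k, p, fun I hI => ?_⟩
  obtain ⟨T, σ, hr, hT, h0, h1⟩ := hp I I.finalTab_cnt_le
  refine ⟨T, σ, hr, hT, ?_⟩
  obtain ⟨G, hG⟩ := I.sound_finalTab
  have hout := h1 G hG.chain (hG.lt _)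
  obtain ⟨h, -, hh⟩ := hI.exists_rank
  by_cases hF : I.finalTab.F (I.diag I.t) = 0
  · exact .inr ⟨by rw [h0, if_pos hF], fun B hB => (hB.cheap hI).1 hF⟩
  refine .inl ⟨by rw [h0, if_neg hF], fun i => ?_, fun B hB => ?_⟩
  · have hreach := hG.reach (fun _ => I.t) (by rwa [← I.diag_eq_enc])
    rw [← I.diag_eq_enc] at hreach
    obtain ⟨l, hl, hl'⟩ := hreach i
    refine ⟨l, hl.isDipath hh, fun a ha => Finset.mem_inter.mpr ⟨?_, (hl' a ha).2⟩⟩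
    simp only [SimPaths.SimInstance.outputArcs, Finset.mem_filter, Finset.mem_univ, true_and]
    exact (hout a).mpr (.inr (hl' a ha).1)
  · -- split every cost into its positive part, the price, and its negative part
    have hsplit : ∀ A : Finset (Fin I.m), ∑ a ∈ A, I.cost a =
        ∑ a ∈ A, I.price a + ∑ a ∈ A, min (I.cost a) 0 := fun A => by
      rw [← Finset.sum_add_distrib]
      exact Finset.sum_congr rfl fun a _ => by
        rw [SimPaths.SimInstance.price, max_add_min, add_zero]
    have hmem : ∀ a, a ∈ I.outputArcs σ ↔
        I.cost a < 0 ∨ a ∈ G (I.finalTab.F (I.diag I.t)) := fun a => by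
      rw [← hout a]; simp [SimPaths.SimInstance.outputArcs]
    have hneg : ∑ a ∈ I.outputArcs σ, min (I.cost a) 0 = ∑ a, min (I.cost a) 0 :=
      Finset.sum_subset (Finset.subset_univ _) fun a _ ha => by
        rw [hmem, not_or, not_lt] at ha
        exact min_eq_right ha.1
    have hneg' : ∑ a, min (I.cost a) 0 ≤ ∑ a ∈ B, min (I.cost a) 0 := by
      have := Finset.sum_le_sum_of_subset_of_nonneg (f := fun a => -min (I.cost a) 0)
        (Finset.subset_univ B) fun a _ _ => neg_nonneg.mpr (min_le_right _ _)
      simpa using this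
    have hpos : ∑ a ∈ I.outputArcs σ, I.price a ≤
        ∑ a ∈ G (I.finalTab.F (I.diag I.t)), I.price a := by
      refine (Finset.sum_subset (s₁ := G (I.finalTab.F (I.diag I.t)))
        (fun a ha => (hmem a).mpr (.inr ha)) fun a ha ha' => ?_).ge
      exact max_eq_right (((hmem a).mp ha).resolve_right ha').le
    have h₁ := hG.cost _ (hG.lt (I.diag I.t))
    have h₂ := (hB.cheap hI).2
    rw [hsplit, hsplit, hneg]
    linarith
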